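/- Let $X$ be a (real or complex) Banach space, $1\le p<\infty$, let $(A,D(A))$ be the generator of a strongly continuous semigroup $(S(t))_{t\ge 0}$ on $X$, and let $\Phi:W^{1,p}([-1,0],X)\to X$ be a bounded linear operator. On the Banach space $\mathcal E:=X\times L^p([-1,0],X)$ with norm $\|(x,f)\|=\|x\|+\|f\|_p$ consider the operator $$\mathcal A\binom{x}{f}:=\binom{Ax+\Phi f}{f'},\qquad D(\mathcal A):=\left\{\binom{x}{f}\in D(A)\times W^{1,p}([-1,0],X)\ :\ f(0)=x\right\}.$$ For $r\ge 0$ and $\tau\in[-1,0]$ put $(S_r x)(\tau):=S(r+\tau)x$ if $-r<\tau\le 0$ and $(S_rx)(\tau):=0$ if $-1\le\tau\le -r$; and let $(T_0(r)f)(\tau):=f(r+\tau)$ if $r+\tau\le 0$ and $(T_0(r)f)(\tau):=0$ otherwise (the nilpotent left shift semigroup on $L^p([-1,0],X)$). Suppose that condition (M) holds: there exist $t_0>0$ and $0\le q<1$ such that $$\int_0^{t_0}\bigl\|\Phi\bigl(S_r x+T_0(r)f\bigr)\bigr\|\,dr\ \le\ q\,\left\|\binom{x}{f}\right\|\qquad\text{for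 all }\binom{x}{f}\in D(\mathcal A).$$ Then $(\mathcal A,D(\mathcal A))$ is the generator of a strongly continuous semigroup on $\mathcal E$. Moreover, the delay equation $$u'(t)=Au(t)+\Phi u_t\quad(t\ge 0),\qquad u(0)=x,\qquad u_0=f,\qquad\text{where } u_t(\sigma):=u(t+\sigma),\ \sigma\in[-1,0],$$ is well-posed in the following sense, where a solution is a function $u\in C([-1,\infty),X)\cap C^1([0,\infty),X)$ with $u(t)\in D(A)$ and $u_t\in W^{1,p}([-1,0],X)$ for all $t\ge 0$ that satisfies the equation for all $t\ge 0$ and the initial conditions: (i) for every $(x,f)\in D(\mathcal A)$ there is a unique solution $u(x,f,\cdot)$; (ii) if a sequence $(x_n,f_n)$ in $D(\mathcal A)$ converges in $\mathcal E$ to $(x,f)\in D(\mathcal A)$, then $u(x_n,f_n,t)\to u(x,f,t)$ uniformly for $t$ in compact subintervals of $[0,\infty)$. -/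

import Mathlib

open MeasureTheory Set Filter Topology
open scoped ENNReal ContDiff

namespace DelayEq

/-- Lebesgue measure on the interval `[-1, 0]`. -/
noncomputable abbrev histMeasure : Measure ℝ := volume.restrict (Icc (-1 : ℝ) 0)

/-- The space `L^p([-1,0], X)`. -/
noncomputable abbrev HistLp (X : Type*) [NormedAddCommGroup X] (p : ℝ≥0∞) := Lp X p histMeasure

/-- The state space `X × L^p([-1,0], X)` with the norm `‖x‖ + ‖f‖_p`. -/
noncomputable abbrev StateSpace (X : Type*) [NormedAddCommGroup X] (p : ℝ≥0∞) :=
  WithLp 1 (X × HistLp X p)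

/-! ### Strongly continuous semigroups and generators -/

/-- A strongly continuous semigroup `(T(t))_{t ≥ 0}` of bounded linear operators on `Y`
(the values at negative times play no role). -/
structure C0Semigroup (𝕜 Y : Type*) [RCLike 𝕜] [NormedAddCommGroup Y] [NormedSpace 𝕜 Y] where
  toFun : ℝ → Y →L[𝕜] Y
  map_zero : toFun 0 = ContinuousLinearMap.id 𝕜 Y
  map_add : ∀ s t : ℝ, 0 ≤ s → 0 ≤ t → toFun (s + t) = (toFun s).comp (toFun t)
  continuousOn_orbit : ∀ y : Y, ContinuousOn (fun t => toFun t y) (Ici 0)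

/-- `A` (with its domain) is the generator of the semigroup `S`:
`y ∈ D(A)` and `A y = z` exactly if `(S(h) y - y) / h → z` as `h ↓ 0`. -/
def C0Semigroup.HasGenerator {𝕜 Y : Type*} [RCLike 𝕜] [NormedAddCommGroup Y] [NormedSpace 𝕜 Y]
    [NormedSpace ℝ Y] (S : C0Semigroup 𝕜 Y) (A : Y →ₗ.[𝕜] Y) : Prop :=
  ∀ y z : Y, (y, z) ∈ A.graph ↔
    Tendsto (fun h : ℝ => h⁻¹ • (S.toFun h y - y)) (𝓝[>] 0) (𝓝 z)

/-- `A` generates some strongly continuous semigroup. -/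
def IsGenerator {𝕜 Y : Type*} [RCLike 𝕜] [NormedAddCommGroup Y] [NormedSpace 𝕜 Y]
    [NormedSpace ℝ Y] (A : Y →ₗ.[𝕜] Y) : Prop :=
  ∃ S : C0Semigroup 𝕜 Y, S.HasGenerator A

set_option linter.unusedSectionVars false

section Sobolev

variable {𝕜 X : Type*} [RCLike 𝕜] [NormedAddCommGroup X] [NormedSpace 𝕜 X] [NormedSpace ℝ X]
  {p : ℝ≥0∞}

/-! ### The Sobolev space `W^{1,p}([-1,0], X)` -/

/-- `g` is the weak derivative of `f` on `(-1, 0)`. -/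
def HasWeakDeriv (f g : HistLp X p) : Prop :=
  ∀ φ : ℝ → ℝ, ContDiff ℝ ∞ φ → HasCompactSupport φ → tsupport φ ⊆ Ioo (-1 : ℝ) 0 →
    ∫ σ in Icc (-1 : ℝ) 0, deriv φ σ • f σ = -∫ σ in Icc (-1 : ℝ) 0, φ σ • g σ

theorem integrable_hist [Fact (1 ≤ p)] (f : HistLp X p) : Integrable f histMeasure :=
  (Lp.memLp f).integrable Fact.out

theorem integrable_smul_hist [Fact (1 ≤ p)] (f : HistLp X p) {φ : ℝ → ℝ} (hφ : Continuous φ)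
    (hc : HasCompactSupport φ) : Integrable (fun σ => φ σ • f σ) histMeasure := by
  obtain ⟨C, hC⟩ := hc.exists_bound_of_continuous hφ
  exact (integrable_hist f).bdd_smul C hφ.aestronglyMeasurable (ae_of_all _ hC)

theorem integrable_deriv_smul_hist [Fact (1 ≤ p)] (f : HistLp X p) {φ : ℝ → ℝ}
    (hφ : ContDiff ℝ ∞ φ) (hc : HasCompactSupport φ) :
    Integrable (fun σ => deriv φ σ • f σ) histMeasure :=
  integrable_smul_hist f (hφ.continuous_deriv (by simp)) hc.deriv

theorem HasWeakDeriv.add [Fact (1 ≤ p)] {f₁ g₁ f₂ g₂ : HistLp X p}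
    (h₁ : HasWeakDeriv f₁ g₁) (h₂ : HasWeakDeriv f₂ g₂) :
    HasWeakDeriv (f₁ + f₂) (g₁ + g₂) := by
  intro φ hφ hc hs
  have e1 : ∫ σ in Icc (-1 : ℝ) 0, deriv φ σ • (f₁ + f₂ : HistLp X p) σ
      = ∫ σ in Icc (-1 : ℝ) 0, (deriv φ σ • f₁ σ + deriv φ σ • f₂ σ) := by
    refine integral_congr_ae ?_
    filter_upwards [Lp.coeFn_add f₁ f₂] with σ h
    rw [h, Pi.add_apply, smul_add]
  have e2 : ∫ σ in Icc (-1 : ℝ) 0, φ σ • (g₁ + g₂ : HistLp X p) σ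
      = ∫ σ in Icc (-1 : ℝ) 0, (φ σ • g₁ σ + φ σ • g₂ σ) := by
    refine integral_congr_ae ?_
    filter_upwards [Lp.coeFn_add g₁ g₂] with σ h
    rw [h, Pi.add_apply, smul_add]
  rw [e1, e2, integral_add (integrable_deriv_smul_hist f₁ hφ hc)
    (integrable_deriv_smul_hist f₂ hφ hc), integral_add
    (integrable_smul_hist g₁ hφ.continuous hc) (integrable_smul_hist g₂ hφ.continuous hc),
    h₁ φ hφ hc hs, h₂ φ hφ hc hs, neg_add]

theorem HasWeakDeriv.smul [IsScalarTower ℝ 𝕜 X] {f g : HistLp X p} (c : 𝕜)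
    (h : HasWeakDeriv f g) : HasWeakDeriv (c • f) (c • g) := by
  intro φ hφ hc hs
  have e1 : ∫ σ in Icc (-1 : ℝ) 0, deriv φ σ • (c • f : HistLp X p) σ
      = ∫ σ in Icc (-1 : ℝ) 0, c • (deriv φ σ • f σ) := by
    refine integral_congr_ae ?_
    filter_upwards [Lp.coeFn_smul c f] with σ h
    rw [h, Pi.smul_apply, smul_comm]
  have e2 : ∫ σ in Icc (-1 : ℝ) 0, φ σ • (c • g : HistLp X p) σ
      = ∫ σ in Icc (-1 : ℝ) 0, c • (φ σ • g σ) := by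
    refine integral_congr_ae ?_
    filter_upwards [Lp.coeFn_smul c g] with σ h
    rw [h, Pi.smul_apply, smul_comm]
  rw [e1, e2, integral_smul, integral_smul, h φ hφ hc hs, smul_neg]

theorem HasWeakDeriv.zero : HasWeakDeriv (0 : HistLp X p) 0 := by
  intro φ _ _ _
  have e (ψ : ℝ → ℝ) : ∫ σ in Icc (-1 : ℝ) 0, ψ σ • (0 : HistLp X p) σ = 0 := by
    refine integral_eq_zero_of_ae ?_
    filter_upwards [Lp.coeFn_zero X p histMeasure] with σ h
    rw [h, Pi.zero_apply, smul_zero]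
  rw [e, e, neg_zero]

/-- Weak derivatives are unique. -/
theorem HasWeakDeriv.unique [CompleteSpace X] [Fact (1 ≤ p)] {f g₁ g₂ : HistLp X p}
    (h₁ : HasWeakDeriv f g₁) (h₂ : HasWeakDeriv f g₂) : g₁ = g₂ := by
  have hint : Integrable (fun σ => g₁ σ - g₂ σ) histMeasure :=
    (integrable_hist g₁).sub (integrable_hist g₂)
  have key := (isOpen_Ioo (a := (-1 : ℝ)) (b := 0)).ae_eq_zero_of_integral_contDiff_smul_eq_zero
    (μ := histMeasure) (f := fun σ => g₁ σ - g₂ σ)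
    (hint.locallyIntegrable.locallyIntegrableOn _) (by
      intro φ hφ hc hs
      have e := (h₁ φ hφ hc hs).symm.trans (h₂ φ hφ hc hs)
      simp only [smul_sub]
      rw [integral_sub (integrable_smul_hist g₁ hφ.continuous hc)
        (integrable_smul_hist g₂ hφ.continuous hc), sub_eq_zero]
      exact neg_injective e)
  have hIoo : ∀ᵐ σ ∂histMeasure, σ ∈ Ioo (-1 : ℝ) 0 := by
    rw [histMeasure, ← restrict_Ioo_eq_restrict_Icc]
    exact ae_restrict_mem measurableSet_Ioo
  refine Lp.ext ?_
  filter_upwards [key, hIoo] with σ h hσ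
  exact sub_eq_zero.1 (h hσ)

variable (𝕜 X p) in
/-- `W^{1,p}([-1,0], X)` as a subspace of `L^p([-1,0], X)`. -/
def sobolev [IsScalarTower ℝ 𝕜 X] [Fact (1 ≤ p)] : Submodule 𝕜 (HistLp X p) where
  carrier := {f | ∃ g : HistLp X p, HasWeakDeriv f g}
  zero_mem' := ⟨0, HasWeakDeriv.zero⟩
  add_mem' := fun ⟨g₁, h₁⟩ ⟨g₂, h₂⟩ => ⟨g₁ + g₂, h₁.add h₂⟩
  smul_mem' := fun c _ ⟨g, h⟩ => ⟨c • g, h.smul c⟩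

variable [IsScalarTower ℝ 𝕜 X] [CompleteSpace X] [Fact (1 ≤ p)]

variable (𝕜 X p) in
/-- The weak derivative `d/dσ : W^{1,p}([-1,0], X) → L^p([-1,0], X)`. -/
noncomputable def weakDeriv : sobolev 𝕜 X p →ₗ[𝕜] HistLp X p where
  toFun f := f.2.choose
  map_add' f g := (f + g).2.choose_spec.unique (f.2.choose_spec.add g.2.choose_spec)
  map_smul' c f := (c • f).2.choose_spec.unique (f.2.choose_spec.smul c)

/-- The characteristic property of `weakDeriv`. -/
theorem hasWeakDeriv_weakDeriv (f : sobolev 𝕜 X p) :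
    HasWeakDeriv (f : HistLp X p) (weakDeriv 𝕜 X p f) :=
  f.2.choose_spec

/-- `Φ : W^{1,p}([-1,0], X) → X` is bounded for the norm `‖f‖_p + ‖f'‖_p` of `W^{1,p}`. -/
def SobolevBounded (Φ : sobolev 𝕜 X p →ₗ[𝕜] X) : Prop :=
  ∃ C : ℝ, ∀ f : sobolev 𝕜 X p, ‖Φ f‖ ≤ C * (‖(f : HistLp X p)‖ + ‖weakDeriv 𝕜 X p f‖)

/-- `f(0) = x`: the class `f` has a representative that is continuous on `[-1,0]` and takes the
value `x` at `0` (each `f ∈ W^{1,p}` has exactly one continuous representative). -/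
def HasValueAtZero (f : HistLp X p) (x : X) : Prop :=
  ∃ F : ℝ → X, ContinuousOn F (Icc (-1 : ℝ) 0) ∧ f =ᵐ[histMeasure] F ∧ F 0 = x

/-! ### The delay operator -/

/-- The domain `{(x, f) ∈ D(A) × W^{1,p} : f(0) = x}`. -/
def delayDomain (p : ℝ≥0∞) [Fact (1 ≤ p)] (A : X →ₗ.[𝕜] X) :
    Submodule 𝕜 (StateSpace X p) where
  carrier := {ξ | ξ.fst ∈ A.domain ∧ ξ.snd ∈ sobolev 𝕜 X p ∧ HasValueAtZero ξ.snd ξ.fst}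
  zero_mem' := ⟨A.domain.zero_mem, (sobolev 𝕜 X p).zero_mem,
    fun _ => 0, continuousOn_const, Lp.coeFn_zero X p histMeasure, rfl⟩
  add_mem' := by
    rintro ξ η ⟨h1, h2, F, hF, hfF, hF0⟩ ⟨k1, k2, G, hG, hgG, hG0⟩
    refine ⟨A.domain.add_mem h1 k1, (sobolev 𝕜 X p).add_mem h2 k2, F + G, hF.add hG, ?_, ?_⟩
    · exact (Lp.coeFn_add ξ.snd η.snd).trans (hfF.add hgG)
    · simp [hF0, hG0]
  smul_mem' := by
    rintro c ξ ⟨h1, h2, F, hF, hfF, hF0⟩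
    refine ⟨A.domain.smul_mem c h1, (sobolev 𝕜 X p).smul_mem c h2, c • F, hF.const_smul c, ?_, ?_⟩
    · exact (Lp.coeFn_smul c ξ.snd).trans (hfF.const_smul c)
    · simp [hF0]

/-- The operator matrix `(x, f) ↦ (A x + Φ f, f')` with domain `delayDomain p A`. -/
noncomputable def delayOp (A : X →ₗ.[𝕜] X) (Φ : sobolev 𝕜 X p →ₗ[𝕜] X) :
    StateSpace X p →ₗ.[𝕜] StateSpace X p where
  domain := delayDomain p A
  toFun :=
    { toFun := fun ξ => WithLp.toLp 1
        (A ⟨ξ.1.fst, ξ.2.1⟩ + Φ ⟨ξ.1.snd, ξ.2.2.1⟩, weakDeriv 𝕜 X p ⟨ξ.1.snd, ξ.2.2.1⟩)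
      map_add' := fun ξ η => by
        have hA := A.map_add ⟨ξ.1.fst, ξ.2.1⟩ ⟨η.1.fst, η.2.1⟩
        have hΦ := Φ.map_add ⟨ξ.1.snd, ξ.2.2.1⟩ ⟨η.1.snd, η.2.2.1⟩
        have hD := (weakDeriv 𝕜 X p).map_add ⟨ξ.1.snd, ξ.2.2.1⟩ ⟨η.1.snd, η.2.2.1⟩
        rw [← WithLp.toLp_add, Prod.mk_add_mk, ← hD, add_add_add_comm, ← hA, ← hΦ]
        rfl
      map_smul' := fun c ξ => by
        have hA := A.map_smul c ⟨ξ.1.fst, ξ.2.1⟩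
        have hΦ := Φ.map_smul c ⟨ξ.1.snd, ξ.2.2.1⟩
        have hD := (weakDeriv 𝕜 X p).map_smul c ⟨ξ.1.snd, ξ.2.2.1⟩
        rw [RingHom.id_apply, ← WithLp.toLp_smul, Prod.smul_mk, ← hD, smul_add, ← hA, ← hΦ]
        rfl }

/-! ### Solutions and well-posedness of the delay equation -/

/-- `u : [-1,∞) → X` is a classical solution of `u'(t) = A u(t) + Φ u_t` for `t ≥ 0`, `u(0) = x`,
`u_0 = f`. Only the values of `u` on `[-1,∞)` matter; `w` is the class of
`u_t = u(t + ·)` on `[-1,0]`. -/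
def IsSolution (A : X →ₗ.[𝕜] X) (Φ : sobolev 𝕜 X p →ₗ[𝕜] X) (x : X) (f : HistLp X p)
    (u : ℝ → X) : Prop :=
  ContinuousOn u (Ici (-1)) ∧ ContDiffOn ℝ 1 u (Ici 0) ∧
  (∀ t : ℝ, 0 ≤ t → ∃ (hu : u t ∈ A.domain) (w : sobolev 𝕜 X p),
    ((w : HistLp X p) =ᵐ[histMeasure] fun σ => u (t + σ)) ∧
    derivWithin u (Ici 0) t = A ⟨u t, hu⟩ + Φ w) ∧
  u 0 = x ∧ f =ᵐ[histMeasure] u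

/-- Well-posedness of the delay equation: for all initial values in `delayDomain p A` there is a
unique solution (on `[-1,∞)`), and if initial values in `delayDomain p A` converge in the state
space to an element of `delayDomain p A`, then the solutions converge uniformly on compact
time intervals. -/
def WellPosed (A : X →ₗ.[𝕜] X) (Φ : sobolev 𝕜 X p →ₗ[𝕜] X) : Prop :=
  (∀ ξ ∈ delayDomain p A, ∃ u : ℝ → X, IsSolution A Φ ξ.fst ξ.snd u ∧
    ∀ v : ℝ → X, IsSolution A Φ ξ.fst ξ.snd v → EqOn v u (Ici (-1))) ∧
  (∀ (ξ : ℕ → StateSpace X p) (ζ : StateSpace X p), (∀ n, ξ n ∈ delayDomain p A) →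
    ζ ∈ delayDomain p A → Tendsto ξ atTop (𝓝 ζ) →
    ∀ (u : ℕ → ℝ → X) (v : ℝ → X), (∀ n, IsSolution A Φ (ξ n).fst (ξ n).snd (u n)) →
      IsSolution A Φ ζ.fst ζ.snd v →
      ∀ b : ℝ, 0 ≤ b → TendstoUniformlyOn u v atTop (Icc 0 b))

/-! ### The condition (M) -/

/-- The nilpotent left shift `T₀(r)` on `L^p([-1,0], X)`: `(T₀(r) f)(τ) = f(r + τ)` if
`r + τ ∈ [-1,0]`, and `0` otherwise. -/
noncomputable def leftShift (r : ℝ) (f : HistLp X p) : HistLp X p :=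
  MemLp.toLp (fun τ => (Icc (-1 : ℝ) 0).indicator f (r + τ))
    ((((memLp_indicator_iff_restrict measurableSet_Icc).2 (Lp.memLp f)).comp_measurePreserving
      (measurePreserving_add_left volume r)).restrict (Icc (-1 : ℝ) 0))

/-- The orbit segment `S_r x ∈ L^p([-1,0], X)`: `(S_r x)(τ) = S(r + τ) x` if `-r < τ ≤ 0`, and `0`
if `-1 ≤ τ ≤ -r`. -/
noncomputable def orbitSegment (p : ℝ≥0∞) (S : C0Semigroup 𝕜 X) (r : ℝ) (x : X) : HistLp X p :=
  MemLp.toLp (fun τ => (Ioc (-r) 0).indicator (fun τ => S.toFun (r + τ) x) τ) (by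
    have hc : ContinuousOn (fun τ => S.toFun (r + τ) x) (Icc (-r) 0) :=
      (S.continuousOn_orbit x).comp (by fun_prop) (fun τ hτ => by
        have := hτ.1
        simp only [mem_Ici]
        linarith)
    obtain ⟨C, hC⟩ := isCompact_Icc.exists_bound_of_continuousOn hc
    have hm : AEStronglyMeasurable
        ((Ioc (-r) 0).indicator (fun τ => S.toFun (r + τ) x)) volume :=
      (aestronglyMeasurable_indicator_iff measurableSet_Ioc).2
        ((hc.mono Ioc_subset_Icc_self).aestronglyMeasurable measurableSet_Ioc)
    refine MemLp.of_bound hm.restrict (max C 0) (ae_of_all _ fun τ => ?_)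
    by_cases hτ : τ ∈ Ioc (-r) 0
    · rw [indicator_of_mem hτ]
      exact (hC τ (Ioc_subset_Icc_self hτ)).trans (le_max_left _ _)
    · rw [indicator_of_notMem hτ, norm_zero]
      exact le_max_right _ _)

open scoped Classical in
/-- `‖Φ g‖` for `g ∈ W^{1,p}`, extended by `0` to `L^p`. In condition (M) it is only used for
`g = S_r x + T₀(r) f` with `(x, f) ∈ delayDomain p A`, which always lies in `W^{1,p}` (it is the
second component of the unperturbed delay semigroup, which leaves `delayDomain p A` invariant). -/
noncomputable def normPhi (Φ : sobolev 𝕜 X p →ₗ[𝕜] X) (g : HistLp X p) : ℝ :=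
  if h : g ∈ sobolev 𝕜 X p then ‖Φ ⟨g, h⟩‖ else 0

/-- Condition (M): there are `t₀ > 0` and `0 ≤ q < 1` with
`∫₀^{t₀} ‖Φ (S_r x + T₀(r) f)‖ dr ≤ q ‖(x, f)‖` for all `(x, f) ∈ delayDomain p A`. -/
def ConditionM (A : X →ₗ.[𝕜] X) (S : C0Semigroup 𝕜 X) (Φ : sobolev 𝕜 X p →ₗ[𝕜] X) : Prop :=
  ∃ t₀ q : ℝ, 0 < t₀ ∧ 0 ≤ q ∧ q < 1 ∧ ∀ ξ ∈ delayDomain p A,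
    ∫ r in (0 : ℝ)..t₀, normPhi Φ (orbitSegment p S r ξ.fst + leftShift r ξ.snd) ≤ q * ‖ξ‖

end Sobolev

end DelayEq

/-!
The delay operator `(x, f) ↦ (A x + Φ f, f')` is the sum of the unperturbed delay operator
`(x, f) ↦ (A x, f')`, with the same domain, and of `(x, f) ↦ (Φ f, 0)`.

The unperturbed operator generates `(x, f) ↦ (S(t) x, S_t x + T₀(t) f)`: if `u` is the curve glued
from the history `f` and the orbit `S(·) x`, this is `(u(t), u_t)`. All facts about it come from two
properties of history segments. First, `t ↦ u_t` is continuous in `L^p` for locally `p`-integrable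
`u` (continuity of translations, `LocLp.continuous_hist`). Second, if `U` is a primitive of `u`,
then `U_t` is weakly differentiable on `[-1, 0]` with derivative `u_t`, and `t ↦ U_t` is
differentiable in `L^p` with derivative `u_t` (`LocLp.hasWeakDeriv_hist`,
`LocLp.hasDerivAt_hist`). Conversely `f ∈ W^{1,p}` with `f(0) = x` is `x + ∫₀^σ f'`
(`LocLp.hist_prim_eq`). This identifies the generator in `genRel_delaySemigroup_iff`.

Condition (M) says that the second summand satisfies the hypothesis of the perturbation theorem of
Miyadera and Voigt, `exists_miyadera_semigroup`. The perturbed semigroup solves the Duhamel equation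
`U(t) y = T(t) y + ∫₀ᵗ U(t - s) B T(s) y ds` on the domain, by a Neumann series for a Volterra
operator that is a strict contraction in an exponentially weighted norm. Its generator extends
`G + B`, and equals it because `λ - G - B` is onto for large `λ`: for `R = ∫₀^{t₀} e^{-λs} T(s) ds`
one has `(λ - G - B) R = 1 - e^{-λt₀} T(t₀) - B R`, a small perturbation of the identity.

For well-posedness, `t ↦ (u(t), u_t)` solves the abstract Cauchy problem whenever `u` solves the
delay equation, so that `u` is the first component of an orbit (`IsSolution.eq_orbit`); uniqueness
and continuous dependence follow. For existence (`exists_isSolution`), the second component of an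
orbit in the domain differs from the segments of the first component by some `d` with `d' = ∂_σ d`,
`d(t)(0) = 0` and `d(0) = 0`; then `(0, d)` is an orbit of the unperturbed semigroup starting
at `0`, whence `d = 0`.
-/

namespace DelayEq

set_option linter.unusedSectionVars false

/-! ### Strongly continuous semigroups -/

section Semigroup

variable {𝕜 Y : Type*} [RCLike 𝕜] [NormedAddCommGroup Y] [NormedSpace 𝕜 Y] [NormedSpace ℝ Y]

theorem hasDerivWithinAt_Ioi_iff_tendsto {f : ℝ → Y} {f' : Y} {a : ℝ} :
    HasDerivWithinAt f f' (Ioi a) a ↔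
      Tendsto (fun h : ℝ => h⁻¹ • (f (a + h) - f a)) (𝓝[>] 0) (𝓝 f') := by
  rw [hasDerivWithinAt_iff_tendsto_slope' (by simp)]
  have : 𝓝[>] a = map (fun h => a + h) (𝓝[>] 0) := by
    rw [map_add_left_nhdsGT, add_zero]
  rw [this, tendsto_map'_iff]
  refine tendsto_congr fun h => ?_
  simp [slope_def_module]

namespace C0Semigroup

/-- The graph of the generator of `S` as a relation: `(S(h) y - y) / h → z` as `h ↓ 0`. -/
def GenRel (S : C0Semigroup 𝕜 Y) (y z : Y) : Prop :=
  Tendsto (fun h : ℝ => h⁻¹ • (S.toFun h y - y)) (𝓝[>] 0) (𝓝 z)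

/-- All orbits of `S` are continuous on the whole real line. The values of `S` at negative times
are arbitrary, so this is a normalisation that spares restrictions to `[0, ∞)`. -/
def IsCont (S : C0Semigroup 𝕜 Y) : Prop := ∀ y : Y, Continuous fun t => S.toFun t y

/-- The semigroup `S`, with `S(t)` replaced by `S(0)` at negative times. -/
def normalize (S : C0Semigroup 𝕜 Y) : C0Semigroup 𝕜 Y where
  toFun t := S.toFun (max t 0)
  map_zero := by simp [S.map_zero]
  map_add s t hs ht := by
    rw [max_eq_left hs, max_eq_left ht, max_eq_left (add_nonneg hs ht), S.map_add s t hs ht]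
  continuousOn_orbit y :=
    (S.continuousOn_orbit y).comp (by fun_prop) fun t _ => le_max_right t 0

theorem normalize_apply (S : C0Semigroup 𝕜 Y) {t : ℝ} (ht : 0 ≤ t) :
    S.normalize.toFun t = S.toFun t := by
  simp [normalize, ht]

theorem isCont_normalize (S : C0Semigroup 𝕜 Y) : S.normalize.IsCont := fun y =>
  (S.continuousOn_orbit y).comp_continuous (by fun_prop) fun t => le_max_right t 0

theorem genRel_normalize (S : C0Semigroup 𝕜 Y) {y z : Y} :
    S.normalize.GenRel y z ↔ S.GenRel y z := by
  refine tendsto_congr' ?_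
  filter_upwards [self_mem_nhdsWithin] with h hh
  rw [S.normalize_apply (le_of_lt hh)]

variable {S : C0Semigroup 𝕜 Y}

theorem apply_zero (S : C0Semigroup 𝕜 Y) (y : Y) : S.toFun 0 y = y := by
  rw [S.map_zero]; rfl

theorem apply_add (S : C0Semigroup 𝕜 Y) {s t : ℝ} (hs : 0 ≤ s) (ht : 0 ≤ t) (y : Y) :
    S.toFun (s + t) y = S.toFun s (S.toFun t y) := by
  rw [S.map_add s t hs ht]; rfl

theorem genRel_iff_hasDerivWithinAt {y z : Y} :
    S.GenRel y z ↔ HasDerivWithinAt (fun t => S.toFun t y) z (Ioi 0) 0 := by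
  rw [hasDerivWithinAt_Ioi_iff_tendsto]
  simp [GenRel, S.apply_zero]

theorem GenRel.unique {y z z' : Y} (h : S.GenRel y z) (h' : S.GenRel y z') : z = z' :=
  tendsto_nhds_unique h h'

theorem GenRel.add {y z y' z' : Y} (h : S.GenRel y z) (h' : S.GenRel y' z') :
    S.GenRel (y + y') (z + z') := by
  refine (Tendsto.add h h').congr fun t => ?_
  rw [(S.toFun t).map_add, ← smul_add]
  congr 1
  abel

theorem genRel_zero : S.GenRel 0 0 := by simp [GenRel]

/-- Semigroup operators are bounded uniformly on compact time intervals. -/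
theorem exists_bound [CompleteSpace Y] (S : C0Semigroup 𝕜 Y) (b : ℝ) :
    ∃ C : ℝ, 0 ≤ C ∧ ∀ t ∈ Icc 0 b, ‖S.toFun t‖ ≤ C := by
  obtain ⟨C, hC⟩ := banach_steinhaus (g := fun t : Icc (0 : ℝ) b => S.toFun t) (fun y => by
    obtain ⟨C, hC⟩ := isCompact_Icc.exists_bound_of_continuousOn
      ((S.continuousOn_orbit y).mono Icc_subset_Ici_self)
    exact ⟨C, fun t => hC t t.2⟩)
  exact ⟨max C 0, le_max_right _ _, fun t ht => (hC ⟨t, ht⟩).trans (le_max_left _ _)⟩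

theorem exists_exp_bound [CompleteSpace Y] (S : C0Semigroup 𝕜 Y) {τ lam : ℝ} (hτ : 0 < τ)
    (hlam : 0 ≤ lam) (h : Real.exp (-lam * τ) * ‖S.toFun τ‖ ≤ 1) :
    ∃ M : ℝ, 0 ≤ M ∧ ∀ t, 0 ≤ t → ‖S.toFun t‖ ≤ M * Real.exp (lam * t) := by
  obtain ⟨C, hC0, hC⟩ := S.exists_bound τ
  have hτ' : ‖S.toFun τ‖ ≤ Real.exp (lam * τ) := by
    rw [neg_mul, Real.exp_neg, inv_mul_le_iff₀ (Real.exp_pos _), mul_one] at h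
    exact h
  have key : ∀ n : ℕ, ∀ t, 0 ≤ t → t ≤ n * τ → ‖S.toFun t‖ ≤ C * Real.exp (lam * t) := by
    intro n
    induction n with
    | zero =>
      intro t ht ht'
      refine (hC t ⟨ht, by simp at ht'; linarith⟩).trans (le_mul_of_one_le_right hC0 ?_)
      exact Real.one_le_exp (by positivity)
    | succ n ih =>
      intro t ht ht'
      rcases le_total t τ with h1 | h1
      · exact (hC t ⟨ht, h1⟩).trans (le_mul_of_one_le_right hC0 (Real.one_le_exp (by positivity)))
      · have e : S.toFun t = (S.toFun τ).comp (S.toFun (t - τ)) := by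
          rw [← S.map_add _ _ hτ.le (by linarith)]; congr 1; ring
        rw [e]
        refine (ContinuousLinearMap.opNorm_comp_le _ _).trans ?_
        have := ih (t - τ) (by linarith) (by push_cast at ht'; linarith)
        calc ‖S.toFun τ‖ * ‖S.toFun (t - τ)‖
            ≤ Real.exp (lam * τ) * (C * Real.exp (lam * (t - τ))) := by gcongr
          _ = C * (Real.exp (lam * τ) * Real.exp (lam * (t - τ))) := by ring
          _ = C * Real.exp (lam * t) := by rw [← Real.exp_add]; ring_nf
  refine ⟨C, hC0, fun t ht => ?_⟩
  obtain ⟨n, hn⟩ := exists_nat_ge (t / τ)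
  exact key n t ht ((div_le_iff₀ hτ).1 hn)

/-- Joint continuity of `(t, y) ↦ S(t) y`. -/
theorem tendsto_apply [CompleteSpace Y] (hS : S.IsCont) {ι : Type*} {l : Filter ι} {s : ι → ℝ}
    {v : ι → Y} {s₀ : ℝ} {v₀ : Y} (hs : Tendsto s l (𝓝 s₀)) (hs' : ∀ᶠ i in l, 0 ≤ s i)
    (hv : Tendsto v l (𝓝 v₀)) : Tendsto (fun i => S.toFun (s i) (v i)) l (𝓝 (S.toFun s₀ v₀)) := by
  obtain ⟨C, hC0, hC⟩ := S.exists_bound (s₀ + 1)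
  have h1 : Tendsto (fun i => S.toFun (s i) v₀) l (𝓝 (S.toFun s₀ v₀)) :=
    ((hS v₀).tendsto s₀).comp hs
  have h2 : Tendsto (fun i => S.toFun (s i) (v i - v₀)) l (𝓝 0) := by
    have h3 : Tendsto (fun i => C * ‖v i - v₀‖) l (𝓝 0) := by
      simpa using (tendsto_iff_norm_sub_tendsto_zero.1 hv).const_mul C
    refine squeeze_zero_norm' ?_ h3
    filter_upwards [hs', hs.eventually (gt_mem_nhds (lt_add_one s₀))] with i hi hi'
    exact (S.toFun (s i)).le_of_opNorm_le (hC _ ⟨hi, hi'.le⟩) _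
  simpa using h1.add h2

variable [IsScalarTower ℝ 𝕜 Y]

theorem map_real (L : Y →L[𝕜] Y) (r : ℝ) (y : Y) : L (r • y) = r • L y :=
  map_real_smul L L.continuous r y

theorem GenRel.smul {y z : Y} (h : S.GenRel y z) (c : 𝕜) : S.GenRel (c • y) (c • z) := by
  refine (Tendsto.const_smul h c).congr fun t => ?_
  rw [map_smul, ← smul_sub, smul_comm]

/-- The semigroup maps the graph of its generator into itself. -/
theorem GenRel.map {y z : Y} (h : S.GenRel y z) {t : ℝ} (ht : 0 ≤ t) :
    S.GenRel (S.toFun t y) (S.toFun t z) := by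
  refine (((S.toFun t).continuous.tendsto z).comp h).congr' ?_
  filter_upwards [self_mem_nhdsWithin] with r hr
  have hr : 0 < r := hr
  rw [Function.comp_apply, map_real, map_sub, ← S.apply_add ht hr.le, ← S.apply_add hr.le ht,
    add_comm]

theorem GenRel.hasDerivWithinAt {y z : Y} (h : S.GenRel y z) {t : ℝ} (ht : 0 ≤ t) :
    HasDerivWithinAt (fun s => S.toFun s y) (S.toFun t z) (Ioi t) t := by
  rw [hasDerivWithinAt_Ioi_iff_tendsto]
  refine (h.map ht).congr' ?_
  filter_upwards [self_mem_nhdsWithin] with r hr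
  have hr : 0 < r := hr
  rw [add_comm t r, S.apply_add hr.le ht]

variable [CompleteSpace Y]

theorem intervalIntegrable (hS : S.IsCont) (y : Y) (a b : ℝ) :
    IntervalIntegrable (fun s => S.toFun s y) volume a b :=
  (hS y).intervalIntegrable a b

theorem GenRel.integral_eq {y z : Y} (hS : S.IsCont) (h : S.GenRel y z) {t : ℝ} (ht : 0 ≤ t) :
    ∫ s in (0 : ℝ)..t, S.toFun s z = S.toFun t y - y := by
  have := intervalIntegral.integral_eq_sub_of_hasDeriv_right (a := 0) (b := t)
    (hS y).continuousOn (f' := fun s => S.toFun s z) (fun x hx => h.hasDerivWithinAt (by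
      rw [min_eq_left ht] at hx; exact hx.1.le)) (intervalIntegrable hS z _ _)
  rw [this, S.apply_zero]

theorem hasDerivAt_integral (hS : S.IsCont) (z : Y) (t : ℝ) :
    HasDerivAt (fun t => ∫ s in (0 : ℝ)..t, S.toFun s z) (S.toFun t z) t :=
  intervalIntegral.integral_hasDerivAt_right (intervalIntegrable hS z _ _)
    ((hS z).stronglyMeasurableAtFilter _ _) (hS z).continuousAt

theorem genRel_iff_integral {y z : Y} (hS : S.IsCont) :
    S.GenRel y z ↔ ∀ t : ℝ, 0 ≤ t → ∫ s in (0 : ℝ)..t, S.toFun s z = S.toFun t y - y := by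
  refine ⟨fun h t ht => h.integral_eq hS ht, fun h => ?_⟩
  rw [genRel_iff_hasDerivWithinAt]
  have h1 : HasDerivWithinAt (fun t => (∫ s in (0 : ℝ)..t, S.toFun s z) + y) z (Ioi 0) 0 := by
    have := (hasDerivAt_integral hS z 0).hasDerivWithinAt (s := Ioi 0)
    rw [S.apply_zero] at this
    exact this.add_const y
  refine h1.congr (fun t ht => ?_) ?_
  · rw [h t (le_of_lt ht)]; abel
  · simp [S.apply_zero]

/-- `∫₀ᵗ S(s) y ds` belongs to the domain of the generator, which maps it to `S(t) y - y`. -/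
theorem genRel_integral (hS : S.IsCont) (y : Y) {t : ℝ} (ht : 0 ≤ t) :
    S.GenRel (∫ s in (0 : ℝ)..t, S.toFun s y) (S.toFun t y - y) := by
  rw [genRel_iff_hasDerivWithinAt]
  have hd : HasDerivAt (fun h => (∫ s in (0 : ℝ)..(t + h), S.toFun s y)
      - ∫ s in (0 : ℝ)..h, S.toFun s y) (S.toFun t y - y) 0 := by
    have h1 := (hasDerivAt_integral hS y (t + 0)).comp_const_add t 0
    have h2 := hasDerivAt_integral hS y 0
    rw [S.apply_zero] at h2
    rw [add_zero] at h1
    exact h1.sub h2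
  refine hd.hasDerivWithinAt.congr (fun h hh => ?_) ?_
  · have hh : 0 < h := hh
    rw [← ContinuousLinearMap.intervalIntegral_comp_comm _ (intervalIntegrable hS y _ _)]
    have e : ∫ s in (0 : ℝ)..t, S.toFun h (S.toFun s y) = ∫ s in (0 : ℝ)..t, S.toFun (s + h) y := by
      refine intervalIntegral.integral_congr fun s hs => ?_
      rw [uIcc_of_le ht] at hs
      rw [add_comm s h, S.apply_add hh.le hs.1]
    rw [e, intervalIntegral.integral_comp_add_right (fun s => S.toFun s y), zero_add,
      intervalIntegral.integral_interval_sub_left (intervalIntegrable hS y _ _)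
        (intervalIntegrable hS y _ _)]
  · simp [S.apply_zero]

theorem continuous_integral (hS : S.IsCont) {t : ℝ} (ht : 0 ≤ t) :
    Continuous fun z => ∫ s in (0 : ℝ)..t, S.toFun s z := by
  obtain ⟨C, hC0, hC⟩ := S.exists_bound t
  let F : Y →+ Y :=
    { toFun := fun z => ∫ s in (0 : ℝ)..t, S.toFun s z
      map_zero' := by simp
      map_add' := fun y z => by
        simp only [_root_.map_add]
        exact intervalIntegral.integral_add (intervalIntegrable hS y _ _)
          (intervalIntegrable hS z _ _) }
  refine AddMonoidHomClass.continuous_of_bound F (C * t) fun z => ?_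
  have := intervalIntegral.norm_integral_le_of_norm_le_const (a := 0) (b := t)
    (f := fun s => S.toFun s z) (C := C * ‖z‖) (fun s hs => by
      rw [uIoc_of_le ht] at hs
      exact (S.toFun s).le_of_opNorm_le (hC s ⟨hs.1.le, hs.2⟩) z)
  rw [sub_zero, abs_of_nonneg ht] at this
  calc ‖F z‖ ≤ C * ‖z‖ * t := this
    _ = C * t * ‖z‖ := by ring

variable (S) in
/-- The graph of the generator as a subspace of `Y × Y`. -/
def graph : Submodule 𝕜 (Y × Y) where
  carrier := {w | S.GenRel w.1 w.2}
  zero_mem' := genRel_zero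
  add_mem' h h' := GenRel.add h h'
  smul_mem' c _ h := GenRel.smul h c

/-- The generator is a closed operator. -/
theorem isClosed_graph (hS : S.IsCont) : IsClosed (S.graph : Set (Y × Y)) := by
  have : (S.graph : Set (Y × Y)) = ⋂ t : Ici (0 : ℝ),
      {w | ∫ s in (0 : ℝ)..t, S.toFun s w.2 = S.toFun t w.1 - w.1} := by
    ext w
    simp only [mem_iInter, mem_ofPred_eq, Subtype.forall, mem_Ici]
    exact genRel_iff_integral hS
  rw [this]
  refine isClosed_iInter fun t => isClosed_eq ((continuous_integral hS t.2).comp continuous_snd) ?_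
  exact ((S.toFun t).continuous.comp continuous_fst).sub continuous_fst

variable (S) in
/-- The domain of the generator. -/
def dom : Submodule 𝕜 Y where
  carrier := {y | ∃ z, S.GenRel y z}
  zero_mem' := ⟨0, genRel_zero⟩
  add_mem' := fun ⟨z, h⟩ ⟨z', h'⟩ => ⟨z + z', h.add h'⟩
  smul_mem' := fun c _ ⟨z, h⟩ => ⟨c • z, h.smul c⟩

theorem dense_dom (hS : S.IsCont) : Dense (S.dom : Set Y) := by
  intro y
  have h1 : Tendsto (fun h : ℝ => h⁻¹ • ∫ s in (0 : ℝ)..h, S.toFun s y) (𝓝[>] 0) (𝓝 y) := by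
    have := hasDerivWithinAt_Ioi_iff_tendsto.1 ((hasDerivAt_integral hS y 0).hasDerivWithinAt
      (s := Ioi 0))
    simpa [S.apply_zero] using this
  refine mem_closure_of_tendsto h1 ?_
  filter_upwards [self_mem_nhdsWithin] with h hh
  have := (genRel_integral hS y (le_of_lt hh)).smul ((h⁻¹ : ℝ) : 𝕜)
  rw [← RCLike.real_smul_eq_coe_smul] at this
  exact ⟨_, this⟩

/-- The rescaled semigroup `e^{-λt} S(t)`. -/
noncomputable def rescale (S : C0Semigroup 𝕜 Y) (lam : ℝ) : C0Semigroup 𝕜 Y where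
  toFun t := Real.exp (-lam * t) • S.toFun t
  map_zero := by simp [S.map_zero]
  map_add s t hs ht := by
    ext y
    simp only [smul_apply, ContinuousLinearMap.comp_apply]
    rw [map_real, S.apply_add hs ht, smul_smul, ← Real.exp_add]
    ring_nf
  continuousOn_orbit y := by
    simp only [smul_apply]
    exact ContinuousOn.smul (by fun_prop) (S.continuousOn_orbit y)

theorem rescale_apply (lam t : ℝ) (y : Y) :
    (S.rescale lam).toFun t y = Real.exp (-lam * t) • S.toFun t y := rfl

theorem isCont_rescale (hS : S.IsCont) (lam : ℝ) : (S.rescale lam).IsCont := fun y => by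
  simp only [rescale_apply]
  exact Continuous.smul (by fun_prop) (hS y)

theorem GenRel.rescale {y z : Y} (h : S.GenRel y z) (lam : ℝ) :
    (S.rescale lam).GenRel y (z - lam • y) := by
  rw [genRel_iff_hasDerivWithinAt] at h ⊢
  have h1 : HasDerivWithinAt (fun t : ℝ => Real.exp (-lam * t)) (-lam) (Ioi 0) 0 := by
    have := ((hasDerivAt_id (0 : ℝ)).const_mul (-lam)).exp
    simpa using this.hasDerivWithinAt
  have := h1.smul h
  simp only [mul_zero, Real.exp_zero, one_smul, S.apply_zero, neg_smul] at this
  rwa [← sub_eq_add_neg] at this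

theorem genRel_of_rescale {y z : Y} {lam : ℝ} (h : (S.rescale lam).GenRel y z) :
    S.GenRel y (z + lam • y) := by
  have := h.rescale (-lam)
  have e : (S.rescale lam).rescale (-lam) = S := by
    have : ((S.rescale lam).rescale (-lam)).toFun = S.toFun := by
      ext t y
      rw [rescale_apply, rescale_apply, smul_smul, ← Real.exp_add]
      simp
    cases S
    simp only [C0Semigroup.rescale] at this ⊢
    congr
  rwa [e, neg_smul, sub_neg_eq_add] at this

/-- An eigenvector `y` of the generator with eigenvalue `λ` satisfies `S(t) y = e^{λt} y`. -/
theorem GenRel.apply_of_eigenvector (hS : S.IsCont) {y : Y} {lam : ℝ} (h : S.GenRel y (lam • y))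
    {t : ℝ} (ht : 0 ≤ t) : Real.exp (-lam * t) • S.toFun t y = y := by
  have := (h.rescale lam).integral_eq (isCont_rescale hS lam) ht
  simp only [sub_self, _root_.map_zero, intervalIntegral.integral_zero, rescale_apply] at this
  exact (sub_eq_zero.1 this.symm)

/-- Classical solutions of the abstract Cauchy problem are orbits of the semigroup. A right
derivative is enough. -/
theorem eq_orbit_of_hasDerivWithinAt (hS : S.IsCont) {η : ℝ → Y} (hη : ContinuousOn η (Ici 0))
    (hd : ∀ t, 0 ≤ t → ∃ z, S.GenRel (η t) z ∧ HasDerivWithinAt η z (Ioi t) t) {t : ℝ}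
    (ht : 0 ≤ t) : η t = S.toFun t (η 0) := by
  -- The function `s ↦ S(t - s) η(s)` has vanishing right derivative.
  have hc : ContinuousOn (fun s => S.toFun (t - s) (η s)) (Icc 0 t) := by
    intro s hs
    refine tendsto_apply hS (l := 𝓝[Icc 0 t] s) ?_ ?_ ?_
    · exact (Continuous.tendsto (by fun_prop) s).mono_left nhdsWithin_le_nhds
    · filter_upwards [self_mem_nhdsWithin] with r hr
      linarith [hr.2]
    · exact (hη s hs.1).mono_left (nhdsWithin_mono _ Icc_subset_Ici_self)
  have hz : ∀ s ∈ Ico 0 t, HasDerivWithinAt (fun s => S.toFun (t - s) (η s)) 0 (Ici s) s := by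
    intro s hs
    obtain ⟨z, hz, hzd⟩ := hd s hs.1
    rw [← hasDerivWithinAt_Ioi_iff_Ici, hasDerivWithinAt_Ioi_iff_tendsto]
    rw [hasDerivWithinAt_Ioi_iff_tendsto] at hzd
    have h1 : Tendsto (fun h : ℝ => h⁻¹ • (η (s + h) - η s) - h⁻¹ • (S.toFun h (η s) - η s))
        (𝓝[>] 0) (𝓝 0) := by
      simpa using hzd.sub hz
    have hsm : ∀ᶠ h in 𝓝[>] (0 : ℝ), h < t - s :=
      nhdsWithin_le_nhds (gt_mem_nhds (by linarith [hs.2]))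
    have h2 : Tendsto (fun h : ℝ => t - s - h) (𝓝[>] 0) (𝓝 (t - s)) := by
      have : Tendsto (fun h : ℝ => t - s - h) (𝓝 0) (𝓝 (t - s - 0)) :=
        Continuous.tendsto (by fun_prop) 0
      rw [sub_zero] at this
      exact this.mono_left nhdsWithin_le_nhds
    have h3 := tendsto_apply hS h2 (hsm.mono fun h hh => by linarith) h1
    rw [_root_.map_zero] at h3
    refine h3.congr' ?_
    filter_upwards [hsm, self_mem_nhdsWithin] with h hh hh0
    have hh0 : 0 < h := hh0
    have e : S.toFun (t - s) (η s) = S.toFun (t - s - h) (S.toFun h (η s)) := by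
      rw [← S.apply_add (by linarith) hh0.le]; ring_nf
    rw [e, ← smul_sub, map_real, sub_sub_sub_cancel_right, map_sub, ← sub_sub]
  have := constant_of_has_deriv_right_zero hc hz t ⟨ht, le_rfl⟩
  simpa [S.apply_zero] using this

end C0Semigroup

end Semigroup

/-! ### The perturbation theorem of Miyadera and Voigt -/

section Miyadera

variable {𝕜 Y : Type*} [RCLike 𝕜] [NormedAddCommGroup Y] [NormedSpace 𝕜 Y] [NormedSpace ℝ Y]
  [IsScalarTower ℝ 𝕜 Y] [CompleteSpace Y]

/-- A strongly continuous family of operators with `‖F(t)‖ ≤ K e^{λ t}` for `t ≥ 0`, and bounded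
by `K` for `t ≤ 0`. -/
structure IsExpFamily (lam K : ℝ) (F : ℝ → Y →L[𝕜] Y) : Prop where
  cont : ∀ y : Y, Continuous fun t => F t y
  bound : ∀ t, ‖F t‖ ≤ K * Real.exp (lam * max t 0)

theorem IsExpFamily.continuous_uncurry {lam K : ℝ} {F : ℝ → Y →L[𝕜] Y} (hF : IsExpFamily lam K F) :
    Continuous fun w : ℝ × Y => F w.1 w.2 := by
  rw [continuous_iff_continuousAt]
  rintro ⟨t, y⟩
  have h1 : Tendsto (fun w : ℝ × Y => F w.1 y) (𝓝 (t, y)) (𝓝 (F t y)) :=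
    ((hF.cont y).tendsto t).comp (continuous_fst.tendsto (t, y))
  have h2 : Tendsto (fun w : ℝ × Y => F w.1 (w.2 - y)) (𝓝 (t, y)) (𝓝 0) := by
    have h3 : Tendsto (fun w : ℝ × Y => K * Real.exp (lam * max w.1 0) * ‖w.2 - y‖)
        (𝓝 (t, y)) (𝓝 0) := by
      have : Continuous fun w : ℝ × Y => K * Real.exp (lam * max w.1 0) * ‖w.2 - y‖ := by
        fun_prop
      simpa using this.tendsto (t, y)
    exact squeeze_zero_norm (fun w => (F w.1).le_of_opNorm_le (hF.bound w.1) _) h3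
  simpa [ContinuousAt] using h1.add h2

variable {T : C0Semigroup 𝕜 Y} {B : Y →ₗ[𝕜] Y}

/-- The unbounded perturbation `B` is bounded on the domain of the generator of `T` with the graph
norm. Here `B` is an everywhere defined linear map, whose values off that domain are irrelevant. -/
def GraphBounded (T : C0Semigroup 𝕜 Y) (B : Y →ₗ[𝕜] Y) : Prop :=
  ∃ C : ℝ, ∀ y z, T.GenRel y z → ‖B y‖ ≤ C * (‖y‖ + ‖z‖)

theorem GraphBounded.continuous (hB : GraphBounded T B) {y z : ℝ → Y} (hy : Continuous y)
    (hz : Continuous z) (h : ∀ t, T.GenRel (y t) (z t)) : Continuous fun t => B (y t) := by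
  obtain ⟨C, hC⟩ := hB
  rw [continuous_iff_continuousAt]
  intro t
  rw [ContinuousAt, tendsto_iff_norm_sub_tendsto_zero]
  have h3 : Tendsto (fun s => C * (‖y s - y t‖ + ‖z s - z t‖)) (𝓝 t) (𝓝 0) := by
    have : Continuous fun s => C * (‖y s - y t‖ + ‖z s - z t‖) := by fun_prop
    simpa using this.tendsto t
  refine squeeze_zero (fun s => norm_nonneg _) (fun s => ?_) h3
  rw [← map_sub]
  refine hC _ _ ?_
  have := (h s).add ((h t).smul (-1 : 𝕜))
  simpa [← sub_eq_add_neg] using this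

/-- Integration in the graph of the generator, which is complete: the integral of a continuous
curve in the graph stays in the graph, and `B` may be moved under the integral. -/
theorem GraphBounded.norm_apply_integral_le (hT : T.IsCont) (hB : GraphBounded T B) {y z : ℝ → Y}
    (hy : Continuous y) (hz : Continuous z) (h : ∀ t, T.GenRel (y t) (z t)) {a b : ℝ}
    (hab : a ≤ b) : ‖B (∫ t in a..b, y t)‖ ≤ ∫ t in a..b, ‖B (y t)‖ := by
  obtain ⟨C, hC⟩ := hB
  have : CompleteSpace T.graph := (C0Semigroup.isClosed_graph hT).completeSpace_coe
  let γ : ℝ → T.graph := fun t => ⟨(y t, z t), h t⟩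
  have hγ : Continuous γ := (hy.prodMk hz).subtype_mk _
  let P : T.graph →L[𝕜] Y := (ContinuousLinearMap.fst 𝕜 Y Y).comp T.graph.subtypeL
  let Q : T.graph →L[𝕜] Y := (B ∘ₗ P.toLinearMap).mkContinuous (2 * |C|) (fun w => by
    have h1 := hC _ _ w.2
    have h2 : ‖w.1.1‖ ≤ ‖w‖ := norm_fst_le w.1
    have h3 : ‖w.1.2‖ ≤ ‖w‖ := norm_snd_le w.1
    calc ‖B w.1.1‖ ≤ C * (‖w.1.1‖ + ‖w.1.2‖) := h1
      _ ≤ |C| * (‖w.1.1‖ + ‖w.1.2‖) := by gcongr; exact le_abs_self C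
      _ ≤ |C| * (‖w‖ + ‖w‖) := by gcongr
      _ = 2 * |C| * ‖w‖ := by ring)
  have hi : IntervalIntegrable γ volume a b := hγ.intervalIntegrable a b
  have e1 : ∫ t in a..b, y t = P (∫ t in a..b, γ t) := (P.intervalIntegral_comp_comm hi).symm ▸ rfl
  have e2 : B (P (∫ t in a..b, γ t)) = Q (∫ t in a..b, γ t) := rfl
  rw [e1, e2, ← Q.intervalIntegral_comp_comm hi]
  exact intervalIntegral.norm_integral_le_integral_norm hab

/-- The perturbed orbit `s ↦ B T(s) y` of a vector of the domain is continuous. -/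
theorem GraphBounded.continuous_orbit (hN : ∀ t, T.toFun t = T.toFun (max t 0)) (hT : T.IsCont)
    (hB : GraphBounded T B) {y z : Y} (h : T.GenRel y z) :
    Continuous fun s => B (T.toFun s y) :=
  hB.continuous (hT y) (hT z) fun t => by
    rw [hN]; exact h.map (le_max_right t 0)

/-- A Miyadera bound on `[0, t₀]` gives a weighted Miyadera bound on all of `[0, ∞)`. -/
theorem weighted_miyadera (hN : ∀ t, T.toFun t = T.toFun (max t 0)) (hT : T.IsCont)
    (hB : GraphBounded T B) {t₀ q lam : ℝ} (ht₀ : 0 < t₀) (hq : 0 ≤ q)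
    (hM : ∀ y z, T.GenRel y z → ∫ r in (0 : ℝ)..t₀, ‖B (T.toFun r y)‖ ≤ q * ‖y‖)
    (hlam : 0 ≤ lam) (ha : Real.exp (-lam * t₀) * ‖T.toFun t₀‖ < 1) {y z : Y}
    (h : T.GenRel y z) {t : ℝ} (ht : 0 ≤ t) :
    ∫ r in (0 : ℝ)..t, Real.exp (-lam * r) * ‖B (T.toFun r y)‖ ≤
      q / (1 - Real.exp (-lam * t₀) * ‖T.toFun t₀‖) * ‖y‖ := by
  set a := Real.exp (-lam * t₀) * ‖T.toFun t₀‖ with ha_def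
  have ha0 : 0 ≤ a := by positivity
  have hpos : 0 < 1 - a := by linarith
  have hcont : ∀ {y z : Y}, T.GenRel y z →
      Continuous fun r => Real.exp (-lam * r) * ‖B (T.toFun r y)‖ := fun h =>
    Continuous.mul (by fun_prop) (hB.continuous_orbit hN hT h).norm
  have hint : ∀ {y z : Y}, T.GenRel y z → ∀ a b : ℝ,
      IntervalIntegrable (fun r => Real.exp (-lam * r) * ‖B (T.toFun r y)‖) volume a b :=
    fun h a b => (hcont h).intervalIntegrable a b
  have hshort : ∀ {y z : Y}, T.GenRel y z → ∀ t, 0 ≤ t → t ≤ t₀ →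
      ∫ r in (0 : ℝ)..t, Real.exp (-lam * r) * ‖B (T.toFun r y)‖ ≤ q * ‖y‖ := by
    intro y z h t ht htt
    refine le_trans ?_ (hM y z h)
    refine le_trans (intervalIntegral.integral_mono_on ht (hint h _ _)
      ((hB.continuous_orbit hN hT h).norm.intervalIntegrable _ _) (fun r hr => ?_))
      (intervalIntegral.integral_mono_interval le_rfl ht htt
        (Eventually.of_forall fun r => norm_nonneg _)
        ((hB.continuous_orbit hN hT h).norm.intervalIntegrable _ _))
    refine mul_le_of_le_one_left (norm_nonneg _) (Real.exp_le_one_iff.2 ?_)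
    have := mul_nonneg hlam hr.1
    linarith
  have hqq : q ≤ q / (1 - a) := by
    rw [le_div_iff₀ hpos]
    nlinarith
  have key : ∀ n : ℕ, ∀ y z, T.GenRel y z → ∀ t, 0 ≤ t → t ≤ n * t₀ →
      ∫ r in (0 : ℝ)..t, Real.exp (-lam * r) * ‖B (T.toFun r y)‖ ≤ q / (1 - a) * ‖y‖ := by
    intro n
    induction n with
    | zero =>
      intro y z h t ht ht'
      have : t = 0 := le_antisymm (by simpa using ht') ht
      subst this
      simp only [intervalIntegral.integral_same]
      positivity
    | succ n ih =>
      intro y z h t ht ht'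
      rcases le_total t t₀ with h1 | h1
      · refine (hshort h t ht h1).trans ?_
        gcongr
      · rw [← intervalIntegral.integral_add_adjacent_intervals (hint h 0 t₀) (hint h t₀ t)]
        have e : ∫ r in t₀..t, Real.exp (-lam * r) * ‖B (T.toFun r y)‖ = Real.exp (-lam * t₀) *
            ∫ r in (0 : ℝ)..(t - t₀), Real.exp (-lam * r) * ‖B (T.toFun r (T.toFun t₀ y))‖ := by
          rw [← intervalIntegral.integral_const_mul]
          have := intervalIntegral.integral_comp_add_right (a := 0) (b := t - t₀)
            (fun r => Real.exp (-lam * r) * ‖B (T.toFun r y)‖) t₀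
          rw [zero_add, sub_add_cancel] at this
          rw [← this]
          refine intervalIntegral.integral_congr fun r hr => ?_
          rw [uIcc_of_le (by linarith)] at hr
          rw [T.apply_add hr.1 ht₀.le, ← mul_assoc, ← Real.exp_add]
          ring_nf
        rw [e]
        have h2 := ih _ _ (h.map ht₀.le) (t - t₀) (by linarith) (by push_cast at ht'; linarith)
        have h3 : ‖T.toFun t₀ y‖ ≤ ‖T.toFun t₀‖ * ‖y‖ := (T.toFun t₀).le_opNorm y
        have h4 : 0 ≤ q / (1 - a) := by positivity
        calc _ ≤ q * ‖y‖ + Real.exp (-lam * t₀) * (q / (1 - a) * (‖T.toFun t₀‖ * ‖y‖)) := by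
              gcongr
              · exact hshort h t₀ ht₀.le le_rfl
              · exact h2.trans (by gcongr)
          _ = (q + a * (q / (1 - a))) * ‖y‖ := by rw [ha_def]; ring
          _ = q / (1 - a) * ‖y‖ := by
              congr 1
              field_simp
              ring
  obtain ⟨n, hn⟩ := exists_nat_ge (t / t₀)
  exact key n y z h t ht ((div_le_iff₀ ht₀).1 hn)

/-- The weighted Miyadera condition on `[0, ∞)` with weight `e^{-λt}` and constant `q`. -/
def WeightedMiyadera (T : C0Semigroup 𝕜 Y) (B : Y →ₗ[𝕜] Y) (lam q : ℝ) : Prop :=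
  ∀ y z, T.GenRel y z → ∀ t, 0 ≤ t →
    ∫ r in (0 : ℝ)..t, Real.exp (-lam * r) * ‖B (T.toFun r y)‖ ≤ q * ‖y‖

/-- The Volterra operator `G ↦ ∫₀ˢ G(s - r) B T(r) dr` contracts exponentially weighted norms. -/
theorem norm_volterra_le (hN : ∀ t, T.toFun t = T.toFun (max t 0)) (hT : T.IsCont)
    (hB : GraphBounded T B) {lam q K : ℝ} (hW : WeightedMiyadera T B lam q) (hK : 0 ≤ K)
    {G : ℝ → Y →L[𝕜] Y} (hG : ∀ r, 0 ≤ r → ‖G r‖ ≤ K * Real.exp (lam * r)) {y z : Y}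
    (h : T.GenRel y z) {s : ℝ} (hs : 0 ≤ s) :
    ‖∫ r in (0 : ℝ)..s, G (s - r) (B (T.toFun r y))‖ ≤ q * K * Real.exp (lam * s) * ‖y‖ := by
  have hint : IntervalIntegrable (fun r => Real.exp (-lam * r) * ‖B (T.toFun r y)‖) volume 0 s :=
    (Continuous.mul (by fun_prop) (hB.continuous_orbit hN hT h).norm).intervalIntegrable _ _
  calc ‖∫ r in (0 : ℝ)..s, G (s - r) (B (T.toFun r y))‖
      ≤ ∫ r in (0 : ℝ)..s, K * Real.exp (lam * s) * (Real.exp (-lam * r) * ‖B (T.toFun r y)‖) := by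
        refine intervalIntegral.norm_integral_le_of_norm_le hs (ae_of_all _ fun r hr => ?_)
          (hint.const_mul _)
        refine ((G (s - r)).le_of_opNorm_le (hG (s - r) (by linarith [hr.2])) _).trans_eq ?_
        rw [show lam * (s - r) = lam * s + -lam * r by ring, Real.exp_add]
        ring
    _ = K * Real.exp (lam * s) * ∫ r in (0 : ℝ)..s, Real.exp (-lam * r) * ‖B (T.toFun r y)‖ :=
        intervalIntegral.integral_const_mul _ _
    _ ≤ K * Real.exp (lam * s) * (q * ‖y‖) := by
        gcongr
        exact hW y z h s hs
    _ = q * K * Real.exp (lam * s) * ‖y‖ := by ring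

theorem denseRange_subtype_dom (hT : T.IsCont) : DenseRange (T.dom.subtype : T.dom → Y) := by
  have := C0Semigroup.dense_dom hT
  rwa [DenseRange, Submodule.coe_subtype, Subtype.range_coe]

/-- A norm bound for an operator may be checked on the domain of a generator. -/
theorem opNorm_le_of_dom (hT : T.IsCont) {L : Y →L[𝕜] Y} {C : ℝ} (hC : 0 ≤ C)
    (h : ∀ y ∈ T.dom, ‖L y‖ ≤ C * ‖y‖) : ‖L‖ ≤ C :=
  L.opNorm_le_bound hC fun y => isClosed_property (denseRange_subtype_dom hT)
    (isClosed_le L.continuous.norm (continuous_norm.const_mul C)) (fun a => h a.1 a.2) y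

theorem eq_of_eqOn_dom (hT : T.IsCont) {L L' : Y →L[𝕜] Y} (h : ∀ y ∈ T.dom, L y = L' y) :
    L = L' :=
  ContinuousLinearMap.ext fun y => isClosed_property (denseRange_subtype_dom hT)
    (isClosed_eq L.continuous L'.continuous) (fun a => h a.1 a.2) y

/-- The Volterra operator `F ↦ ∫₀ᵗ F(t - s) B T(s) ds`, with the integral formed on the domain of
the generator and extended by density, maps strongly continuous families to such families. -/
theorem exists_volterra (hN : ∀ t, T.toFun t = T.toFun (max t 0)) (hT : T.IsCont)
    (hB : GraphBounded T B) {lam q : ℝ} (hq : 0 ≤ q) (hlam : 0 ≤ lam)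
    (hW : WeightedMiyadera T B lam q) (K : ℝ) (F : ℝ → Y →L[𝕜] Y) (hK : 0 ≤ K)
    (hF : IsExpFamily lam K F) :
    ∃ F' : ℝ → Y →L[𝕜] Y, IsExpFamily lam (q * K) F' ∧ ∀ y ∈ T.dom, ∀ t, 0 ≤ t →
      F' t y = ∫ s in (0 : ℝ)..t, F (t - s) (B (T.toFun s y)) := by
  have hFG : ∀ r, 0 ≤ r → ‖F r‖ ≤ K * Real.exp (lam * r) := fun r hr => by
    simpa [hr] using hF.bound r
  have hc : ∀ y ∈ T.dom, Continuous fun w : ℝ × ℝ => F (w.1 - w.2) (B (T.toFun w.2 y)) := by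
    rintro y ⟨z, h⟩
    exact hF.continuous_uncurry.comp (Continuous.prodMk (by fun_prop)
      ((hB.continuous_orbit hN hT h).comp continuous_snd))
  have hi : ∀ y ∈ T.dom, ∀ t, IntervalIntegrable (fun s => F (t - s) (B (T.toFun s y)))
      volume 0 t := fun y hy t =>
    ((hc y hy).comp (Continuous.prodMk_right t)).intervalIntegrable _ _
  let f : ℝ → T.dom →ₗ[𝕜] Y := fun t =>
    { toFun := fun y => ∫ s in (0 : ℝ)..t, F (t - s) (B (T.toFun s y))
      map_add' := fun y y' => by
        rw [← intervalIntegral.integral_add (hi y y.2 t) (hi y' y'.2 t)]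
        simp
      map_smul' := fun c y => by
        simp [intervalIntegral.integral_smul] }
  have hf : ∀ t, 0 ≤ t → ∀ y, ‖f t y‖ ≤ q * K * Real.exp (lam * t) * ‖T.dom.subtype y‖ := by
    rintro t ht ⟨y, z, h⟩
    exact norm_volterra_le hN hT hB hW hK hFG h ht
  have hdense := denseRange_subtype_dom hT
  let F' : ℝ → Y →L[𝕜] Y := fun t => (f (max t 0)).extendOfNorm T.dom.subtype
  have hF' : ∀ t, ∀ y : T.dom, F' t y = f (max t 0) y := fun t y =>
    LinearMap.extendOfNorm_eq hdense ⟨_, hf _ (le_max_right t 0)⟩ y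
  have hbound : ∀ t, ‖F' t‖ ≤ q * K * Real.exp (lam * max t 0) := fun t =>
    ContinuousLinearMap.opNorm_le_bound _ (by positivity) fun y =>
      LinearMap.norm_extendOfNorm_apply_le hdense _ (hf _ (le_max_right t 0)) y
  refine ⟨F', ⟨fun y => ?_, hbound⟩, fun y hy t ht => ?_⟩
  · have hdom : ∀ y ∈ T.dom, Continuous fun t => F' t y := by
      intro y hy
      have : Continuous fun t : ℝ => ∫ s in (0 : ℝ)..t, F (t - s) (B (T.toFun s y)) :=
        intervalIntegral.continuous_parametric_intervalIntegral_of_continuous (hc y hy)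
          continuous_id
      have h2 : (fun t => F' t y) = (fun t : ℝ => ∫ s in (0 : ℝ)..t, F (t - s) (B (T.toFun s y))) ∘
          fun t => max t 0 := by
        ext t
        exact hF' t ⟨y, hy⟩
      rw [h2]
      exact this.comp (by fun_prop)
    -- On bounded time intervals the orbit of `y` is a uniform limit of orbits in the domain.
    rw [continuous_iff_continuousAt]
    intro t
    obtain ⟨u, hu, hlim⟩ := mem_closure_iff_seq_limit.1 (C0Semigroup.dense_dom hT y)
    have hloc : TendstoLocallyUniformlyOn (fun n t => F' t (u n)) (fun t => F' t y) atTop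
        (Iio (t + 1)) := by
      refine TendstoUniformlyOn.tendstoLocallyUniformlyOn ?_
      rw [Metric.tendstoUniformlyOn_iff]
      intro ε hε
      have h1 : Tendsto (fun n => q * K * Real.exp (lam * max (t + 1) 0) * ‖y - u n‖) atTop
          (𝓝 0) := by
        have : Tendsto (fun n => ‖y - u n‖) atTop (𝓝 0) := by
          have := (tendsto_const_nhds (x := y)).sub hlim
          simpa using this.norm
        simpa using this.const_mul (q * K * Real.exp (lam * max (t + 1) 0))
      filter_upwards [h1.eventually (gt_mem_nhds hε)] with n hn r hr
      rw [dist_eq_norm, ← map_sub]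
      refine lt_of_le_of_lt ((F' r).le_of_opNorm_le ((hbound r).trans ?_) _) hn
      have hr : r < t + 1 := hr
      gcongr
    have hco : ContinuousOn (fun t => F' t y) (Iio (t + 1)) :=
      hloc.continuousOn (Frequently.of_forall fun n => (hdom _ (hu n)).continuousOn)
    exact hco.continuousAt (Iio_mem_nhds (by linarith))
  · have := hF' t ⟨y, hy⟩
    rw [max_eq_left ht] at this
    exact this

/-- The Neumann series of the Volterra operator solves the Duhamel equation
`U(t) y = T(t) y + ∫₀ᵗ U(t - s) B T(s) y ds`. -/
theorem exists_duhamel (hN : ∀ t, T.toFun t = T.toFun (max t 0)) (hT : T.IsCont)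
    (hB : GraphBounded T B) {lam q M : ℝ} (hq : 0 ≤ q) (hq1 : q < 1) (hlam : 0 ≤ lam)
    (hW : WeightedMiyadera T B lam q) (hM : 0 ≤ M)
    (hTM : ∀ t, 0 ≤ t → ‖T.toFun t‖ ≤ M * Real.exp (lam * t)) :
    ∃ (K : ℝ) (U : ℝ → Y →L[𝕜] Y), 0 ≤ K ∧ IsExpFamily lam K U ∧
      ∀ y ∈ T.dom, ∀ t, 0 ≤ t →
        U t y = T.toFun t y + ∫ s in (0 : ℝ)..t, U (t - s) (B (T.toFun s y)) := by
  have hT0 : IsExpFamily lam M T.toFun := ⟨hT, fun t => by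
    rw [hN]; exact hTM _ (le_max_right t 0)⟩
  choose! V hV1 hV2 using exists_volterra hN hT hB hq hlam hW
  obtain ⟨F, hF0, hFs⟩ : ∃ F : ℕ → ℝ → Y →L[𝕜] Y, F 0 = T.toFun ∧
      ∀ n, F (n + 1) = V (q ^ n * M) (F n) :=
    ⟨fun n => Nat.rec T.toFun (fun n G => V (q ^ n * M) G) n, rfl, fun _ => rfl⟩
  have hF : ∀ n, IsExpFamily lam (q ^ n * M) (F n) := by
    intro n
    induction n with
    | zero => simpa [hF0] using hT0
    | succ n ih =>
      rw [hFs, pow_succ', mul_assoc]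
      exact hV1 _ _ (by positivity) ih
  have hF' : ∀ n, ∀ y ∈ T.dom, ∀ t, 0 ≤ t →
      F (n + 1) t y = ∫ s in (0 : ℝ)..t, F n (t - s) (B (T.toFun s y)) := by
    intro n
    rw [hFs]
    exact hV2 _ _ (by positivity) (hF n)
  have hsum : ∀ c : ℝ, Summable fun n : ℕ => q ^ n * c := fun c =>
    (summable_geometric_of_lt_one hq hq1).mul_right c
  have hsumF : ∀ t, Summable fun n => F n t := fun t => by
    refine Summable.of_norm_bounded (hsum (M * Real.exp (lam * max t 0))) fun n => ?_
    rw [← mul_assoc]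
    exact (hF n).bound t
  let U : ℝ → Y →L[𝕜] Y := fun t => ∑' n, F n t
  have hU : ∀ t y, HasSum (fun n => F n t y) (U t y) := fun t y =>
    (ContinuousLinearMap.apply 𝕜 Y y).hasSum (hsumF t).hasSum
  refine ⟨(1 - q)⁻¹ * M, U, mul_nonneg (inv_nonneg.2 (by linarith)) hM,
    ⟨fun y => ?_, fun t => ?_⟩, fun y hy t ht => ?_⟩
  · have h1 : Continuous fun t => ∑' n, Real.exp (-lam * max t 0) • F n t y := by
      refine continuous_tsum (u := fun n => q ^ n * (M * ‖y‖))
        (fun n => Continuous.smul (by fun_prop) ((hF n).cont y)) (hsum _) fun n t => ?_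
      rw [norm_smul, Real.norm_of_nonneg (Real.exp_pos _).le]
      calc Real.exp (-lam * max t 0) * ‖F n t y‖
          ≤ Real.exp (-lam * max t 0) * (q ^ n * M * Real.exp (lam * max t 0) * ‖y‖) := by
            gcongr
            exact (F n t).le_of_opNorm_le ((hF n).bound t) y
        _ = (Real.exp (-lam * max t 0) * Real.exp (lam * max t 0)) * (q ^ n * (M * ‖y‖)) := by
            ring
        _ = q ^ n * (M * ‖y‖) := by
            rw [← Real.exp_add]
            simp
    have h2 : (fun t => U t y) = fun t =>
        Real.exp (lam * max t 0) • ∑' n, Real.exp (-lam * max t 0) • F n t y := by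
      ext t
      rw [((hU t y).const_smul _).tsum_eq, smul_smul, ← Real.exp_add]
      simp
    rw [h2]
    exact Continuous.smul (by fun_prop) h1
  · have h1 : HasSum (fun n : ℕ => q ^ n * (M * Real.exp (lam * max t 0)))
        ((1 - q)⁻¹ * (M * Real.exp (lam * max t 0))) :=
      (hasSum_geometric_of_lt_one hq hq1).mul_right _
    rw [mul_assoc]
    refine tsum_of_norm_bounded h1 fun n => ?_
    rw [← mul_assoc]
    exact (hF n).bound t
  · obtain ⟨z, hyz⟩ := hy
    have hcy := hB.continuous_orbit hN hT hyz
    have h1 : HasSum (fun n => F (n + 1) t y) (∫ s in (0 : ℝ)..t, U (t - s) (B (T.toFun s y))) := by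
      simp only [hF' _ y ⟨z, hyz⟩ t ht]
      refine intervalIntegral.hasSum_integral_of_dominated_convergence
        (fun n s => q ^ n * (M * (Real.exp (lam * max (t - s) 0) * ‖B (T.toFun s y)‖)))
        (fun n => ?_) (fun n => ae_of_all _ fun s _ => ?_) (ae_of_all _ fun s _ => hsum _) ?_
        (ae_of_all _ fun s _ => ?_)
      · exact ((hF n).continuous_uncurry.comp (Continuous.prodMk (by fun_prop)
          hcy)).aestronglyMeasurable
      · refine ((F n (t - s)).le_of_opNorm_le ((hF n).bound _) _).trans_eq ?_
        ring
      · simp only [tsum_mul_right]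
        exact (continuous_const.mul (continuous_const.mul
          (Continuous.mul (by fun_prop) hcy.norm))).intervalIntegrable _ _
      · exact hU (t - s) (B (T.toFun s y))
    have h2 := (hasSum_nat_add_iff (f := fun n => F n t y) 1).1 h1
    simp only [Finset.range_one, Finset.sum_singleton, hF0] at h2
    rw [(hU t y).unique h2, add_comm]

/-- Solutions of the Duhamel equation form a semigroup: for fixed `t` the defect
`Δ(s) = U(t + s) - U(t) U(s)` solves the homogeneous equation `Δ(s) y = ∫₀ˢ Δ(s - r) B T(r) y dr`,
which has only the zero solution since the Volterra operator is a contraction. -/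
theorem exists_semigroup_of_duhamel (hN : ∀ t, T.toFun t = T.toFun (max t 0)) (hT : T.IsCont)
    (hB : GraphBounded T B) {lam q K : ℝ} (hq : 0 ≤ q) (hq1 : q < 1)
    (hW : WeightedMiyadera T B lam q) {U : ℝ → Y →L[𝕜] Y} (hK : 0 ≤ K)
    (hU : IsExpFamily lam K U)
    (hD : ∀ y ∈ T.dom, ∀ t, 0 ≤ t →
        U t y = T.toFun t y + ∫ s in (0 : ℝ)..t, U (t - s) (B (T.toFun s y))) :
    ∃ W : C0Semigroup 𝕜 Y, W.toFun = U := by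
  have hUG : ∀ r, 0 ≤ r → ‖U r‖ ≤ K * Real.exp (lam * r) := fun r hr => by
    simpa [hr] using hU.bound r
  have hzero : U 0 = ContinuousLinearMap.id 𝕜 Y := eq_of_eqOn_dom hT fun y hy => by
    rw [hD y hy 0 le_rfl, T.apply_zero]
    simp
  have hadd : ∀ t s : ℝ, 0 ≤ t → 0 ≤ s → U (t + s) = (U t).comp (U s) := by
    intro t s ht hs
    let Δ : ℝ → Y →L[𝕜] Y := fun s => U (t + s) - (U t).comp (U s)
    have hΔ : ∀ y ∈ T.dom, ∀ s, 0 ≤ s →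
        Δ s y = ∫ r in (0 : ℝ)..s, Δ (s - r) (B (T.toFun r y)) := by
      rintro y ⟨z, h⟩ s hs
      have hc := hB.continuous_orbit hN hT h
      have hcU : ∀ a : ℝ, Continuous fun r => U (a - r) (B (T.toFun r y)) := fun a =>
        hU.continuous_uncurry.comp (Continuous.prodMk (by fun_prop) hc)
      have hiU : ∀ a b c : ℝ, IntervalIntegrable (fun r => U (a - r) (B (T.toFun r y)))
        volume b c := fun a b c => (hcU a).intervalIntegrable _ _
      have e1 : ∫ r in (0 : ℝ)..s, Δ (s - r) (B (T.toFun r y)) =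
          (∫ r in (0 : ℝ)..s, U (t + s - r) (B (T.toFun r y))) -
            U t (∫ r in (0 : ℝ)..s, U (s - r) (B (T.toFun r y))) := by
        have hi : IntervalIntegrable (fun r => U t (U (s - r) (B (T.toFun r y)))) volume 0 s :=
          ((U t).continuous.comp (hcU s)).intervalIntegrable _ _
        rw [← ContinuousLinearMap.intervalIntegral_comp_comm _ (hiU _ _ _),
          ← intervalIntegral.integral_sub (hiU _ _ _) hi]
        refine intervalIntegral.integral_congr fun r _ => ?_
        simp [Δ, add_sub_assoc]
      have e2 : ∫ r in s..(t + s), U (t + s - r) (B (T.toFun r y)) =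
          ∫ r in (0 : ℝ)..t, U (t - r) (B (T.toFun r (T.toFun s y))) := by
        have := intervalIntegral.integral_comp_add_right (a := 0) (b := t)
          (fun r => U (t + s - r) (B (T.toFun r y))) s
        rw [zero_add] at this
        rw [← this]
        refine intervalIntegral.integral_congr fun r hr => ?_
        rw [uIcc_of_le ht] at hr
        rw [← T.apply_add hr.1 hs]
        ring_nf
      have e3 := hD y ⟨z, h⟩ (t + s) (by positivity)
      rw [← intervalIntegral.integral_add_adjacent_intervals (hiU _ 0 s) (hiU _ s (t + s)), e2,
        T.apply_add ht hs] at e3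
      have e4 := hD (T.toFun s y) ⟨_, h.map hs⟩ t ht
      have e5 := congrArg (U t) (hD y ⟨z, h⟩ s hs)
      rw [map_add] at e5
      rw [e1]
      change U (t + s) y - U t (U s y) = _
      rw [e3, e5, e4]
      abel
    let K₂ : ℝ := K * Real.exp (lam * t) + K * Real.exp (lam * t) * K
    have hbd : ∀ n : ℕ, ∀ s, 0 ≤ s → ‖Δ s‖ ≤ q ^ n * K₂ * Real.exp (lam * s) := by
      intro n
      induction n with
      | zero =>
        intro s hs
        calc ‖Δ s‖ ≤ ‖U (t + s)‖ + ‖U t‖ * ‖U s‖ :=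
              (norm_sub_le _ _).trans (by gcongr; exact ContinuousLinearMap.opNorm_comp_le _ _)
          _ ≤ K * Real.exp (lam * (t + s)) + K * Real.exp (lam * t) * (K * Real.exp (lam * s)) := by
              gcongr
              · exact hUG _ (by positivity)
              · exact hUG _ ht
              · exact hUG _ hs
          _ = q ^ 0 * K₂ * Real.exp (lam * s) := by
              rw [mul_add, Real.exp_add]
              ring
      | succ n ih =>
        intro s hs
        refine opNorm_le_of_dom hT (by positivity) ?_
        rintro y ⟨z, h⟩
        rw [hΔ y ⟨z, h⟩ s hs]
        refine (norm_volterra_le hN hT hB hW (by positivity) ih h hs).trans_eq ?_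
        ring
    have hlim : Tendsto (fun n : ℕ => q ^ n * K₂ * Real.exp (lam * s)) atTop (𝓝 0) := by
      have := ((tendsto_pow_atTop_nhds_zero_of_lt_one hq hq1).mul_const K₂).mul_const
        (Real.exp (lam * s))
      simpa using this
    have : ‖Δ s‖ ≤ 0 := ge_of_tendsto' hlim fun n => hbd n s hs
    exact sub_eq_zero.1 (norm_le_zero_iff.1 this)
  exact ⟨⟨U, hzero, hadd, fun y => (hU.cont y).continuousOn⟩, rfl⟩

/-- The generator of the perturbed semigroup extends `G + B`. -/
theorem genRel_of_duhamel (hN : ∀ t, T.toFun t = T.toFun (max t 0)) (hT : T.IsCont)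
    (hB : GraphBounded T B) {lam K : ℝ} {W : C0Semigroup 𝕜 Y}
    (hU : IsExpFamily lam K W.toFun)
    (hD : ∀ y ∈ T.dom, ∀ t, 0 ≤ t →
        W.toFun t y = T.toFun t y + ∫ s in (0 : ℝ)..t, W.toFun (t - s) (B (T.toFun s y)))
    {y z : Y} (h : T.GenRel y z) : W.GenRel y (z + B y) := by
  have hc : Continuous fun w : ℝ × ℝ => W.toFun (w.1 - w.2) (B (T.toFun w.2 y)) :=
    hU.continuous_uncurry.comp (Continuous.prodMk (by fun_prop)
      ((hB.continuous_orbit hN hT h).comp continuous_snd))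
  have hi : Tendsto (fun t : ℝ => t⁻¹ • ∫ s in (0 : ℝ)..t, W.toFun (t - s) (B (T.toFun s y)))
      (𝓝[>] 0) (𝓝 (B y)) := by
    rw [Metric.tendsto_nhds]
    intro ε hε
    have h0 : W.toFun (0 - 0) (B (T.toFun 0 y)) = B y := by
      rw [sub_zero, W.apply_zero, T.apply_zero]
    obtain ⟨δ, hδ, hδ'⟩ := Metric.continuousAt_iff.1 (hc.continuousAt (x := ((0 : ℝ), (0 : ℝ))))
      (ε / 2) (half_pos hε)
    filter_upwards [self_mem_nhdsWithin, nhdsWithin_le_nhds (gt_mem_nhds hδ)] with t ht htδ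
    have ht : 0 < t := ht
    have e : (t⁻¹ • ∫ s in (0 : ℝ)..t, W.toFun (t - s) (B (T.toFun s y))) - B y =
        t⁻¹ • ∫ s in (0 : ℝ)..t, (W.toFun (t - s) (B (T.toFun s y)) - B y) := by
      have hi : IntervalIntegrable (fun s => W.toFun (t - s) (B (T.toFun s y))) volume 0 t :=
        (hc.comp (Continuous.prodMk_right t)).intervalIntegrable _ _
      rw [intervalIntegral.integral_sub hi intervalIntegrable_const, intervalIntegral.integral_const,
        smul_sub, smul_smul, sub_zero,
        inv_mul_cancel₀ ht.ne', one_smul]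
    rw [dist_eq_norm, e, norm_smul, norm_inv, Real.norm_of_nonneg ht.le]
    have hn := intervalIntegral.norm_integral_le_of_norm_le_const (a := 0) (b := t)
      (f := fun s => W.toFun (t - s) (B (T.toFun s y)) - B y) (C := ε / 2) (fun s hs => by
        rw [uIoc_of_le ht.le] at hs
        have := hδ' (x := (t, s)) (by
          rw [Prod.dist_eq, max_lt_iff, Real.dist_eq, Real.dist_eq]
          simp only [sub_zero]
          rw [abs_of_pos ht, abs_of_pos hs.1]
          exact ⟨htδ, hs.2.trans_lt htδ⟩)
        simp only [h0] at this
        rw [← dist_eq_norm]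
        exact this.le)
    rw [sub_zero, abs_of_pos ht] at hn
    calc t⁻¹ * ‖∫ s in (0 : ℝ)..t, (W.toFun (t - s) (B (T.toFun s y)) - B y)‖
        ≤ t⁻¹ * (ε / 2 * t) := by gcongr
      _ = ε / 2 := by field_simp
      _ < ε := half_lt_self hε
  refine (Tendsto.add h hi).congr' ?_
  filter_upwards [self_mem_nhdsWithin] with t ht
  rw [hD y ⟨z, h⟩ t (le_of_lt ht), ← smul_add]
  congr 1
  abel

theorem tendsto_exp_neg_mul_atTop {t₀ : ℝ} (ht₀ : 0 < t₀) (c : ℝ) :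
    Tendsto (fun lam : ℝ => Real.exp (-lam * t₀) * c) atTop (𝓝 0) := by
  have h1 : Tendsto (fun lam : ℝ => -lam * t₀) atTop atBot :=
    tendsto_neg_atTop_atBot.atBot_mul_const ht₀
  simpa using (Real.tendsto_exp_atBot.comp h1).mul_const c

/-- Under the Miyadera bound `λ - G - B` is onto for large `λ`: with
`R = ∫₀^{t₀} e^{-λs} T(s) ds` one has `(λ - G - B) R = 1 - e^{-λt₀} T(t₀) - B R`, and the last two
terms have total norm less than one. -/
theorem exists_genRel_sub_eq (hN : ∀ t, T.toFun t = T.toFun (max t 0)) (hT : T.IsCont)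
    (hB : GraphBounded T B) {t₀ q lam : ℝ} (ht₀ : 0 < t₀) (hq : 0 ≤ q)
    (hM : ∀ y z, T.GenRel y z → ∫ r in (0 : ℝ)..t₀, ‖B (T.toFun r y)‖ ≤ q * ‖y‖)
    (hlam : 0 ≤ lam) (ha : q + Real.exp (-lam * t₀) * ‖T.toFun t₀‖ < 1) (w : Y) :
    ∃ y z, T.GenRel y z ∧ lam • y - z - B y = w := by
  set S := T.rescale lam with hS
  have hSc : S.IsCont := C0Semigroup.isCont_rescale hT lam
  let R : Y →ₗ[𝕜] Y :=
    { toFun := fun y => ∫ s in (0 : ℝ)..t₀, S.toFun s y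
      map_add' := fun y y' => by
        simp only [map_add]
        exact intervalIntegral.integral_add (C0Semigroup.intervalIntegrable hSc _ _ _)
          (C0Semigroup.intervalIntegrable hSc _ _ _)
      map_smul' := fun c y => by simp [intervalIntegral.integral_smul] }
  have hRc : Continuous R := C0Semigroup.continuous_integral hSc ht₀.le
  have hR : ∀ y, T.GenRel (R y) (S.toFun t₀ y - y + lam • R y) := fun y =>
    C0Semigroup.genRel_of_rescale (C0Semigroup.genRel_integral hSc y ht₀.le)
  have hBRc : Continuous (B ∘ₗ R) := by
    refine continuous_of_continuousAt_zero (B ∘ₗ R) ?_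
    obtain ⟨C, hC⟩ := hB
    have h1 : Continuous fun y => C * (‖R y‖ + ‖S.toFun t₀ y - y + lam • R y‖) := by fun_prop
    have h2 := h1.tendsto 0
    simp only [map_zero, norm_zero, sub_zero, smul_zero, add_zero, mul_zero] at h2
    rw [ContinuousAt, map_zero]
    exact squeeze_zero_norm (fun y => hC _ _ (hR y)) h2
  have hBR : ∀ y, ‖B (R y)‖ ≤ q * ‖y‖ := by
    refine isClosed_property (denseRange_subtype_dom hT) (isClosed_le hBRc.norm (by fun_prop)) ?_
    rintro ⟨y, z, h⟩
    have hgen : ∀ t, T.GenRel (S.toFun t y) (S.toFun t z) := fun t => by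
      have := (h.map (le_max_right t 0)).smul ((Real.exp (-lam * t) : ℝ) : 𝕜)
      rw [← RCLike.real_smul_eq_coe_smul, ← RCLike.real_smul_eq_coe_smul, ← hN] at this
      exact this
    have hcB := hB.continuous (hSc y) (hSc z) hgen
    refine (hB.norm_apply_integral_le hT (hSc y) (hSc z) hgen ht₀.le).trans ?_
    refine le_trans (intervalIntegral.integral_mono_on ht₀.le (hcB.norm.intervalIntegrable _ _)
      ((hB.continuous_orbit hN hT h).norm.intervalIntegrable _ _) fun r hr => ?_) (hM y z h)
    have e : B (S.toFun r y) = ((Real.exp (-lam * r) : ℝ) : 𝕜) • B (T.toFun r y) := by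
      rw [hS, C0Semigroup.rescale_apply, RCLike.real_smul_eq_coe_smul (K := 𝕜), map_smul]
    rw [e, norm_smul, RCLike.norm_ofReal, abs_of_pos (Real.exp_pos _)]
    refine mul_le_of_le_one_left (norm_nonneg _) (Real.exp_le_one_iff.2 ?_)
    have := mul_nonneg hlam hr.1
    linarith
  let P : Y →L[𝕜] Y := S.toFun t₀ + ⟨B ∘ₗ R, hBRc⟩
  have hP : ‖P‖ < 1 := by
    refine lt_of_le_of_lt (P.opNorm_le_bound (by positivity) fun y => ?_) ha
    calc ‖P y‖ ≤ ‖S.toFun t₀ y‖ + ‖B (R y)‖ := norm_add_le _ _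
      _ ≤ Real.exp (-lam * t₀) * (‖T.toFun t₀‖ * ‖y‖) + q * ‖y‖ := by
          refine add_le_add ?_ (hBR y)
          rw [hS, C0Semigroup.rescale_apply, norm_smul, Real.norm_of_nonneg (Real.exp_pos _).le]
          gcongr
          exact (T.toFun t₀).le_opNorm y
      _ = (q + Real.exp (-lam * t₀) * ‖T.toFun t₀‖) * ‖y‖ := by ring
  obtain ⟨J, hJ⟩ := isUnit_one_sub_of_norm_lt_one hP
  have hv : (1 - P) ((↑J⁻¹ : Y →L[𝕜] Y) w) = w := by
    rw [← hJ, ← mul_apply_eq_comp, J.mul_inv]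
    rfl
  set v := (↑J⁻¹ : Y →L[𝕜] Y) w
  refine ⟨R v, _, hR v, ?_⟩
  have e : (1 - P) v = v - (S.toFun t₀ v + B (R v)) := rfl
  rw [← hv, e]
  abel

/-- **Miyadera–Voigt perturbation theorem.** If `B` is bounded for the graph norm of the generator
`G` of `T` and `∫₀^{t₀} ‖B T(r) y‖ dr ≤ q ‖y‖` on its domain with `q < 1`, then `G + B`, with the
domain of `G`, generates a strongly continuous semigroup. -/
theorem exists_miyadera_semigroup (hN : ∀ t, T.toFun t = T.toFun (max t 0)) (hT : T.IsCont)
    (hB : GraphBounded T B) {t₀ q : ℝ} (ht₀ : 0 < t₀) (hq : 0 ≤ q) (hq1 : q < 1)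
    (hM : ∀ y z, T.GenRel y z → ∫ r in (0 : ℝ)..t₀, ‖B (T.toFun r y)‖ ≤ q * ‖y‖) :
    ∃ W : C0Semigroup 𝕜 Y, W.IsCont ∧
      ∀ y w, W.GenRel y w ↔ ∃ z, T.GenRel y z ∧ w = z + B y := by
  have hq1' : 0 < 1 - q := by linarith
  obtain ⟨lam, hlam, ha⟩ := ((eventually_ge_atTop (0 : ℝ)).and
    ((tendsto_exp_neg_mul_atTop ht₀ ‖T.toFun t₀‖).eventually (gt_mem_nhds hq1'))).exists
  set a := Real.exp (-lam * t₀) * ‖T.toFun t₀‖ with ha_def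
  have ha0 : 0 ≤ a := by positivity
  have ha1 : a < 1 := by linarith
  obtain ⟨M, hM0, hTM⟩ := T.exists_exp_bound ht₀ hlam ha1.le
  have hW : WeightedMiyadera T B lam (q / (1 - a)) := fun y z h t ht =>
    weighted_miyadera hN hT hB ht₀ hq hM hlam ha1 h ht
  have hq' : 0 ≤ q / (1 - a) := div_nonneg hq (by linarith)
  have hq'1 : q / (1 - a) < 1 := by
    rw [div_lt_one (by linarith)]
    linarith
  obtain ⟨K, U, hK, hU, hD⟩ := exists_duhamel hN hT hB hq' hq'1 hlam hW hM0 hTM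
  obtain ⟨W, rfl⟩ := exists_semigroup_of_duhamel hN hT hB hq' hq'1 hW hK hU hD
  have hWc : W.IsCont := hU.cont
  have hsub : ∀ {y z : Y}, T.GenRel y z → W.GenRel y (z + B y) :=
    genRel_of_duhamel hN hT hB hU hD
  refine ⟨W, hWc, fun y w => ⟨fun h => ?_, fun ⟨z, hz, e⟩ => e ▸ hsub hz⟩⟩
  -- For large `μ` the operator `μ - G - B` is onto while `μ` is no eigenvalue of the generator
  -- of `W`, which therefore has no larger domain.
  obtain ⟨mu, hmu, hb, hc⟩ := ((eventually_ge_atTop (0 : ℝ)).and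
    (((tendsto_exp_neg_mul_atTop ht₀ ‖T.toFun t₀‖).eventually (gt_mem_nhds hq1')).and
    ((tendsto_exp_neg_mul_atTop ht₀ ‖W.toFun t₀‖).eventually (gt_mem_nhds one_pos)))).exists
  obtain ⟨y', z', h', e⟩ := exists_genRel_sub_eq hN hT hB ht₀ hq hM hmu (by linarith)
    (mu • y - w)
  have hd : W.GenRel (y - y') (mu • (y - y')) := by
    have := h.add ((hsub h').smul (-1 : 𝕜))
    simp only [neg_smul, one_smul, ← sub_eq_add_neg] at this
    have e2 : mu • (y - y') = w - (z' + B y') := by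
      rw [smul_sub]
      have : mu • y = w + (mu • y' - z' - B y') := by rw [e]; abel
      rw [this]
      abel
    rwa [e2]
  have hfix := hd.apply_of_eigenvector hWc ht₀.le
  have hyy : y - y' = 0 := by
    by_contra hne
    have hpos : 0 < ‖y - y'‖ := norm_pos_iff.2 hne
    have : ‖y - y'‖ < ‖y - y'‖ := by
      calc ‖y - y'‖ = ‖Real.exp (-mu * t₀) • W.toFun t₀ (y - y')‖ := by rw [hfix]
        _ ≤ Real.exp (-mu * t₀) * (‖W.toFun t₀‖ * ‖y - y'‖) := by
            rw [norm_smul, Real.norm_of_nonneg (Real.exp_pos _).le]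
            gcongr
            exact (W.toFun t₀).le_opNorm _
        _ = Real.exp (-mu * t₀) * ‖W.toFun t₀‖ * ‖y - y'‖ := by ring
        _ < 1 * ‖y - y'‖ := by gcongr
        _ = ‖y - y'‖ := one_mul _
    exact lt_irrefl _ this
  obtain rfl : y = y' := sub_eq_zero.1 hyy
  exact ⟨z', h', h.unique (hsub h')⟩

end Miyadera

/-! ### History segments of locally `p`-integrable functions -/

section History

variable {X : Type*} [NormedAddCommGroup X] {p : ℝ≥0∞}

/-- `u : ℝ → X` is `p`-integrable on compact intervals. -/
def LocLp (p : ℝ≥0∞) (u : ℝ → X) : Prop := ∀ a b : ℝ, MemLp u p (volume.restrict (Icc a b))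

instance isProbabilityMeasure_histMeasure : IsProbabilityMeasure histMeasure :=
  ⟨by simp [histMeasure]⟩

theorem LocLp.of_continuous {u : ℝ → X} (hu : Continuous u) : LocLp p u := fun a b => by
  obtain ⟨C, hC⟩ := isCompact_Icc.exists_bound_of_continuousOn (hu.continuousOn (s := Icc a b))
  exact MemLp.of_bound (hu.continuousOn.aestronglyMeasurable measurableSet_Icc) C
    ((ae_restrict_iff' measurableSet_Icc).2 (ae_of_all _ hC))

theorem measurePreserving_hist (t : ℝ) :
    MeasurePreserving (fun σ => t + σ) histMeasure (volume.restrict (Icc (t - 1) t)) := by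
  have := (measurePreserving_add_left volume t).restrict_preimage
    (measurableSet_Icc (a := t - 1) (b := t))
  have e : (fun σ => t + σ) ⁻¹' Icc (t - 1) t = Icc (-1) 0 := by
    ext σ
    simp only [mem_preimage, mem_Icc]
    constructor <;> rintro ⟨h1, h2⟩ <;> constructor <;> linarith
  rwa [e] at this

theorem LocLp.memLp_hist {u : ℝ → X} (hu : LocLp p u) (t : ℝ) :
    MemLp (fun σ => u (t + σ)) p histMeasure :=
  (hu (t - 1) t).comp_measurePreserving (measurePreserving_hist t)

open scoped Classical in
/-- The history segment `u_t`, the class of `σ ↦ u(t + σ)` in `L^p([-1,0], X)`; it is `0` if that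
function is not `p`-integrable. -/
noncomputable def hist (p : ℝ≥0∞) (u : ℝ → X) (t : ℝ) : HistLp X p :=
  if h : MemLp (fun σ => u (t + σ)) p histMeasure then h.toLp _ else 0

theorem LocLp.coeFn_hist {u : ℝ → X} (hu : LocLp p u) (t : ℝ) :
    hist p u t =ᵐ[histMeasure] fun σ => u (t + σ) := by
  rw [hist, dif_pos (hu.memLp_hist t)]
  exact MemLp.coeFn_toLp _

theorem LocLp.hist_eq_of_ae {u : ℝ → X} (hu : LocLp p u) {t : ℝ} {f : HistLp X p}
    (h : f =ᵐ[histMeasure] fun σ => u (t + σ)) : hist p u t = f :=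
  Lp.ext ((hu.coeFn_hist t).trans h.symm)

/-- An almost everywhere statement on `[t - 1, t]` may be shifted to `[-1, 0]`. -/
theorem ae_hist_of_ae {P : ℝ → Prop} {t : ℝ} (h : ∀ᵐ r ∂volume.restrict (Icc (t - 1) t), P r) :
    ∀ᵐ σ ∂histMeasure, P (t + σ) :=
  (measurePreserving_hist t).quasiMeasurePreserving.ae h

theorem ae_mem_histInterval : ∀ᵐ σ ∂histMeasure, σ ∈ Icc (-1 : ℝ) 0 :=
  ae_restrict_mem measurableSet_Icc

theorem LocLp.integrableOn [Fact (1 ≤ p)] {u : ℝ → X} (hu : LocLp p u) (a b : ℝ) :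
    IntegrableOn u (Icc a b) :=
  (hu a b).integrable Fact.out

theorem LocLp.intervalIntegrable [Fact (1 ≤ p)] {u : ℝ → X} (hu : LocLp p u) (a b : ℝ) :
    IntervalIntegrable u volume a b :=
  ⟨(hu.integrableOn a b).mono_set Ioc_subset_Icc_self,
    (hu.integrableOn b a).mono_set Ioc_subset_Icc_self⟩

variable [NormedSpace ℝ X]

/-- Continuity of translations in `L^p`, for history segments. -/
theorem LocLp.continuous_hist [Fact (1 ≤ p)] (hp : p ≠ ⊤) {u : ℝ → X} (hu : LocLp p u) :
    Continuous (hist p u) := by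
  rw [continuous_iff_continuousAt]
  intro t₀
  let s : Set ℝ := Icc (t₀ - 2) (t₀ + 1)
  have hv : MemLp (s.indicator u) p volume :=
    (memLp_indicator_iff_restrict measurableSet_Icc).2 (hu _ _)
  let v : Lp X p (volume : Measure ℝ) := hv.toLp _
  have hmp : ∀ t : ℝ, MeasurePreserving (ContinuousMap.addLeft t) volume volume := fun t =>
    measurePreserving_add_left volume t
  have hg : Continuous fun t : ℝ => (ContinuousMap.addLeft t : C(ℝ, ℝ)) :=
    (ContinuousMap.mk (fun w : ℝ × ℝ => w.1 + w.2) continuous_add).curry.continuous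
  have hc : Continuous fun t : ℝ => LpToLpRestrictCLM ℝ X ℝ volume p (Icc (-1) 0)
      (Lp.compMeasurePreserving (ContinuousMap.addLeft t) (hmp t) v) :=
    (LpToLpRestrictCLM ℝ X ℝ volume p (Icc (-1) 0)).continuous.comp
      (Continuous.compMeasurePreservingLp continuous_const hg hmp hp)
  refine hc.continuousAt.congr ?_
  filter_upwards [Ioo_mem_nhds (sub_one_lt t₀) (lt_add_one t₀)] with t ht
  refine (hu.hist_eq_of_ae ?_).symm
  have h1 := LpToLpRestrictCLM_coeFn ℝ (Icc (-1) 0)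
    (Lp.compMeasurePreserving (ContinuousMap.addLeft t) (hmp t) v)
  have h2 : (Lp.compMeasurePreserving (ContinuousMap.addLeft t) (hmp t) v) =ᵐ[histMeasure]
      v ∘ ContinuousMap.addLeft t := ae_restrict_of_ae (Lp.coeFn_compMeasurePreserving v (hmp t))
  have h3 : ∀ᵐ σ ∂histMeasure, v (t + σ) = s.indicator u (t + σ) :=
    ae_restrict_of_ae ((hmp t).quasiMeasurePreserving.ae hv.coeFn_toLp)
  filter_upwards [h1, h2, h3, ae_mem_histInterval] with σ e1 e2 e3 hσ
  rw [e1, e2, Function.comp_apply, ContinuousMap.coe_addLeft, e3, indicator_of_mem]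
  exact ⟨by linarith [hσ.1, ht.1], by linarith [hσ.2, ht.2]⟩

variable [Fact (1 ≤ p)]

/-- Integration over a subset of `[-1, 0]` as a bounded functional on `L^p([-1,0], X)`. -/
noncomputable def setIntegralCLM (p : ℝ≥0∞) [Fact (1 ≤ p)] (E : Set ℝ) : HistLp X p →L[ℝ] X :=
  LinearMap.mkContinuous
    { toFun := fun f => ∫ σ in E, f σ ∂histMeasure
      map_add' := fun f g => by
        rw [← integral_add (integrable_hist f).integrableOn (integrable_hist g).integrableOn]
        exact integral_congr_ae (ae_restrict_of_ae (Lp.coeFn_add f g))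
      map_smul' := fun c f => by
        rw [RingHom.id_apply, ← integral_smul]
        exact integral_congr_ae (ae_restrict_of_ae (Lp.coeFn_smul c f)) } 1 fun f => by
    rw [one_mul]
    have h1 : ‖∫ σ in E, f σ ∂histMeasure‖ ≤ ∫ σ, ‖f σ‖ ∂histMeasure :=
      (norm_integral_le_integral_norm _).trans (setIntegral_le_integral (integrable_hist f).norm
        (ae_of_all _ fun _ => norm_nonneg _))
    refine h1.trans ?_
    rw [integral_norm_eq_lintegral_enorm (Lp.aestronglyMeasurable f),
      ← eLpNorm_one_eq_lintegral_enorm, Lp.norm_def]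
    exact ENNReal.toReal_mono (Lp.eLpNorm_ne_top f)
      (eLpNorm_le_eLpNorm_of_exponent_le Fact.out (Lp.aestronglyMeasurable f))

theorem setIntegralCLM_apply (E : Set ℝ) (f : HistLp X p) :
    setIntegralCLM p E f = ∫ σ in E, f σ ∂histMeasure := rfl

/-- The primitive `x + ∫₀ᵗ u` of `u`. -/
noncomputable def prim (x : X) (u : ℝ → X) (t : ℝ) : X := x + ∫ s in (0 : ℝ)..t, u s

theorem prim_zero (x : X) (u : ℝ → X) : prim x u 0 = x := by simp [prim]

theorem LocLp.prim_sub_prim {u : ℝ → X} (hu : LocLp p u) (x : X) (a b : ℝ) :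
    prim x u b - prim x u a = ∫ s in a..b, u s := by
  rw [prim, prim, add_sub_add_left_eq_sub, intervalIntegral.integral_interval_sub_left
    (hu.intervalIntegrable _ _) (hu.intervalIntegrable _ _)]

theorem LocLp.continuous_prim {u : ℝ → X} (hu : LocLp p u) (x : X) : Continuous (prim x u) :=
  continuous_const.add (intervalIntegral.continuous_primitive hu.intervalIntegrable 0)

variable [CompleteSpace X]

/-- The `L^p`-valued integral of history segments is the segment of the primitive. Both sides are
compared by integration over measurable sets and Fubini's theorem. -/
theorem LocLp.integral_hist_of_le (hp : p ≠ ⊤) {u : ℝ → X} (hu : LocLp p u) (x : X) {a b : ℝ}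
    (hab : a ≤ b) :
    ∫ t in a..b, hist p u t = hist p (prim x u) b - hist p (prim x u) a := by
  have hP : LocLp p (prim x u) := LocLp.of_continuous (hu.continuous_prim x)
  have hi : IntervalIntegrable (hist p u) volume a b :=
    (hu.continuous_hist hp).intervalIntegrable _ _
  -- Integrability of `(t, σ) ↦ u (t + σ)`, by the measure preserving shear `(t, σ) ↦ (t, t + σ)`.
  have hprod : Integrable (fun w : ℝ × ℝ => u (w.1 + w.2))
      ((volume.restrict (Ioc a b)).prod histMeasure) := by
    let v := (Icc (a - 1) b).indicator u
    have hv : Integrable v volume := (hu.integrableOn _ _).integrable_indicator measurableSet_Icc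
    have h1 : Integrable (fun w : ℝ × ℝ => v w.2) ((volume.restrict (Ioc a b)).prod volume) :=
      hv.comp_snd _
    have h2 : Integrable (fun w : ℝ × ℝ => v (w.1 + w.2))
        ((volume.restrict (Ioc a b)).prod volume) :=
      (measurePreserving_prod_add (volume.restrict (Ioc a b))
        (volume : Measure ℝ)).integrable_comp_of_integrable h1
    have h3 : Integrable (fun w : ℝ × ℝ => v (w.1 + w.2))
        ((volume.restrict (Ioc a b)).prod histMeasure) :=
      h2.mono_measure (Measure.prod_mono le_rfl Measure.restrict_le_self)
    refine h3.congr ?_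
    rw [histMeasure, Measure.prod_restrict]
    filter_upwards [ae_restrict_mem (measurableSet_Ioc.prod measurableSet_Icc)] with w hw
    refine indicator_of_mem ?_ _
    exact ⟨by linarith [hw.1.1, hw.2.1], by linarith [hw.1.2, hw.2.2]⟩
  refine Lp.ext ?_
  have hdiff : (hist p (prim x u) b - hist p (prim x u) a : HistLp X p) =ᵐ[histMeasure]
      fun σ => ∫ t in a..b, u (t + σ) := by
    filter_upwards [Lp.coeFn_sub (hist p (prim x u) b) (hist p (prim x u) a), hP.coeFn_hist b,
      hP.coeFn_hist a] with σ e1 e2 e3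
    rw [e1, Pi.sub_apply, e2, e3, hu.prim_sub_prim, intervalIntegral.integral_comp_add_right]
  refine Integrable.ae_eq_of_forall_setIntegral_eq _ _ (integrable_hist _) (integrable_hist _) ?_
  intro E hE _
  rw [setIntegral_congr_ae hE (hdiff.mono fun σ h _ => h), ← setIntegralCLM_apply,
    ← ContinuousLinearMap.intervalIntegral_comp_comm _ hi]
  simp only [intervalIntegral.integral_of_le hab, setIntegralCLM_apply]
  have e : ∀ t, ∫ σ in E, hist p u t σ ∂histMeasure = ∫ σ in E, u (t + σ) ∂histMeasure :=
    fun t => integral_congr_ae (ae_restrict_of_ae (hu.coeFn_hist t))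
  simp only [e]
  exact integral_integral_swap
    (hprod.mono_measure (Measure.prod_mono le_rfl Measure.restrict_le_self))

theorem LocLp.integral_hist (hp : p ≠ ⊤) {u : ℝ → X} (hu : LocLp p u) (x : X) (a b : ℝ) :
    ∫ t in a..b, hist p u t = hist p (prim x u) b - hist p (prim x u) a := by
  rcases le_total a b with h | h
  · exact hu.integral_hist_of_le hp x h
  · rw [intervalIntegral.integral_symm, hu.integral_hist_of_le hp x h, neg_sub]

/-- If `U` is a primitive of `u` then `t ↦ U_t` is differentiable in `L^p` with derivative
`u_t`. -/
theorem LocLp.hasDerivAt_hist (hp : p ≠ ⊤) {u : ℝ → X} (hu : LocLp p u) (x : X) (t : ℝ) :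
    HasDerivAt (hist p (prim x u)) (hist p u t) t := by
  have hc := hu.continuous_hist hp
  have h1 : HasDerivAt (fun t => ∫ s in (0 : ℝ)..t, hist p u s) (hist p u t) t :=
    intervalIntegral.integral_hasDerivAt_right (hc.intervalIntegrable _ _)
      (hc.stronglyMeasurableAtFilter _ _) hc.continuousAt
  have e : hist p (prim x u) =
      fun t => (∫ s in (0 : ℝ)..t, hist p u s) + hist p (prim x u) 0 := by
    ext1 t
    rw [hu.integral_hist hp x, sub_add_cancel]
  rw [e]
  exact h1.add_const _

end History

/-! ### Weak derivatives and primitives -/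

section Sobolev

variable {X : Type*} [NormedAddCommGroup X] [NormedSpace ℝ X] {p : ℝ≥0∞} [Fact (1 ≤ p)]
  [CompleteSpace X]

theorem integrable_hist_of_continuous {E : Type*} [NormedAddCommGroup E] {φ : ℝ → E}
    (hφ : Continuous φ) : Integrable φ histMeasure :=
  Continuous.integrableOn_Icc (μ := volume) hφ

/-- Integration by parts against a test function `φ` that vanishes at `-1`, by Fubini's theorem on
the triangle `{σ < s}`. -/
theorem integral_deriv_smul_integral {g : ℝ → X} (hg : Integrable g histMeasure) {φ : ℝ → ℝ}
    (hφ : ContDiff ℝ ∞ φ) (h1 : φ (-1) = 0) :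
    ∫ σ, deriv φ σ • (∫ s in (0 : ℝ)..σ, g s) ∂histMeasure = -∫ σ, φ σ • g σ ∂histMeasure := by
  have hφc : Continuous (deriv φ) := hφ.continuous_deriv (by simp)
  have hφi : Integrable (deriv φ) histMeasure := integrable_hist_of_continuous hφc
  let k : ℝ → ℝ → X := fun σ s => (Ioi σ).indicator (fun s => deriv φ σ • g s) s
  have hk : Integrable (Function.uncurry k) (histMeasure.prod histMeasure) := by
    have := (hφi.smul_prod hg).indicator
      (measurableSet_lt measurable_fst measurable_snd : MeasurableSet {w : ℝ × ℝ | w.1 < w.2})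
    refine this.congr (ae_of_all _ fun w => ?_)
    simp [k, indicator, Function.uncurry]
  have e1 : ∀ σ ∈ Icc (-1 : ℝ) 0, ∫ s, k σ s ∂histMeasure =
      -(deriv φ σ • ∫ s in (0 : ℝ)..σ, g s) := by
    intro σ hσ
    have : Ioi σ ∩ Icc (-1 : ℝ) 0 = Ioc σ 0 := by
      ext s
      simp only [mem_inter_iff, mem_Ioi, mem_Icc, mem_Ioc]
      exact ⟨fun h => ⟨h.1, h.2.2⟩, fun h => ⟨h.1, by linarith [hσ.1, h.1], h.2⟩⟩
    rw [integral_indicator measurableSet_Ioi, Measure.restrict_restrict measurableSet_Ioi, this,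
      integral_smul, intervalIntegral.integral_symm, intervalIntegral.integral_of_le hσ.2, smul_neg,
      neg_neg]
  have e2 : ∀ s ∈ Icc (-1 : ℝ) 0, ∫ σ, k σ s ∂histMeasure = φ s • g s := by
    intro s hs
    have hks : ∀ σ, k σ s = (Iio s).indicator (fun σ => deriv φ σ • g s) σ := fun σ => by
      simp [k, indicator]
    have : Iio s ∩ Icc (-1 : ℝ) 0 = Ico (-1) s := by
      ext σ
      simp only [mem_inter_iff, mem_Iio, mem_Icc, mem_Ico]
      exact ⟨fun h => ⟨h.2.1, h.1⟩, fun h => ⟨h.2, h.1, by linarith [hs.2, h.2]⟩⟩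
    simp only [hks]
    rw [integral_indicator measurableSet_Iio, Measure.restrict_restrict measurableSet_Iio, this,
      integral_smul_const, restrict_Ico_eq_restrict_Ioc, ← intervalIntegral.integral_of_le hs.1,
      intervalIntegral.integral_deriv_eq_sub (fun x _ => (hφ.differentiable (by simp)) x)
        (hφc.intervalIntegrable _ _), h1, sub_zero]
  have e := integral_integral_swap hk
  rw [integral_congr_ae (ae_mem_histInterval.mono e1),
    integral_congr_ae (ae_mem_histInterval.mono e2), integral_neg] at e
  rw [← e, neg_neg]

theorem testFunction_eq_zero {φ : ℝ → ℝ} (hs : tsupport φ ⊆ Ioo (-1 : ℝ) 0) {σ : ℝ}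
    (h : σ ∉ Ioo (-1 : ℝ) 0) : φ σ = 0 :=
  image_eq_zero_of_notMem_tsupport fun hσ => h (hs hσ)

theorem integral_deriv_testFunction {φ : ℝ → ℝ} (hφ : ContDiff ℝ ∞ φ)
    (hs : tsupport φ ⊆ Ioo (-1 : ℝ) 0) : ∫ σ, deriv φ σ ∂histMeasure = 0 := by
  have hφc : Continuous (deriv φ) := hφ.continuous_deriv (by simp)
  rw [histMeasure, integral_Icc_eq_integral_Ioc, ← intervalIntegral.integral_of_le (by norm_num),
    intervalIntegral.integral_deriv_eq_sub (fun x _ => (hφ.differentiable (by simp)) x)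
      (hφc.intervalIntegrable _ _), testFunction_eq_zero hs (by simp),
    testFunction_eq_zero hs (by simp), sub_zero]

/-- Segments of a primitive are weakly differentiable. -/
theorem LocLp.hasWeakDeriv_hist {u : ℝ → X} (hu : LocLp p u) (x : X) (t : ℝ) :
    HasWeakDeriv (hist p (prim x u) t) (hist p u t) := by
  intro φ hφ hc hs
  have hP : LocLp p (prim x u) := LocLp.of_continuous (hu.continuous_prim x)
  have hφc : Continuous (deriv φ) := hφ.continuous_deriv (by simp)
  have hi : Integrable (fun σ => u (t + σ)) histMeasure :=
    (hu.memLp_hist t).integrable Fact.out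
  have e1 : ∀ σ, prim x u (t + σ) = prim x u t + ∫ s in (0 : ℝ)..σ, u (t + s) := fun σ => by
    rw [intervalIntegral.integral_comp_add_left, add_zero, ← hu.prim_sub_prim x]
    abel
  have hci : Continuous fun σ => ∫ s in (0 : ℝ)..σ, u (t + s) := by
    have : (fun σ => ∫ s in (0 : ℝ)..σ, u (t + s)) =
        fun σ => prim x u (t + σ) - prim x u t := by
      ext σ
      rw [e1, add_sub_cancel_left]
    rw [this]
    have := hu.continuous_prim x
    fun_prop
  have e2 : ∫ σ, deriv φ σ • hist p (prim x u) t σ ∂histMeasure =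
      ∫ σ, (deriv φ σ • prim x u t + deriv φ σ • ∫ s in (0 : ℝ)..σ, u (t + s)) ∂histMeasure := by
    refine integral_congr_ae ?_
    filter_upwards [hP.coeFn_hist t] with σ h
    rw [h, e1, smul_add]
  have e3 : ∫ σ, φ σ • hist p u t σ ∂histMeasure = ∫ σ, φ σ • u (t + σ) ∂histMeasure := by
    refine integral_congr_ae ?_
    filter_upwards [hu.coeFn_hist t] with σ h
    rw [h]
  rw [e2, e3, integral_add, integral_deriv_smul_integral hi hφ
    (testFunction_eq_zero hs (by simp)), integral_smul_const, integral_deriv_testFunction hφ hs,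
    zero_smul, zero_add]
  · exact integrable_hist_of_continuous (hφc.smul continuous_const)
  · exact integrable_hist_of_continuous (hφc.smul hci)

theorem LocLp.hasValueAtZero_hist {u : ℝ → X} (hu : LocLp p u) (x : X) (t : ℝ) :
    HasValueAtZero (hist p (prim x u) t) (prim x u t) := by
  have hc := hu.continuous_prim x
  exact ⟨fun σ => prim x u (t + σ), by fun_prop, (LocLp.of_continuous hc).coeFn_hist t, by simp⟩

/-- A test function on `(-1, 0)` with integral zero is the derivative of a test function. -/
theorem exists_testFunction_deriv_eq {χ : ℝ → ℝ} (hχ : ContDiff ℝ ∞ χ) (hc : HasCompactSupport χ)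
    (hs : tsupport χ ⊆ Ioo (-1 : ℝ) 0) (h0 : ∫ σ, χ σ ∂histMeasure = 0) :
    ∃ φ : ℝ → ℝ, ContDiff ℝ ∞ φ ∧ HasCompactSupport φ ∧ tsupport φ ⊆ Ioo (-1 : ℝ) 0 ∧
      deriv φ = χ := by
  have hχc := hχ.continuous
  have hd : ∀ s, HasDerivAt (fun s => ∫ σ in (-1 : ℝ)..s, χ σ) (χ s) s := fun s =>
    intervalIntegral.integral_hasDerivAt_right (hχc.intervalIntegrable _ _)
      (hχc.stronglyMeasurableAtFilter _ _) hχc.continuousAt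
  have hderiv : deriv (fun s => ∫ σ in (-1 : ℝ)..s, χ σ) = χ := funext fun s => (hd s).deriv
  obtain ⟨a, b, ha, hb, hab⟩ : ∃ a b : ℝ, -1 < a ∧ b < 0 ∧ tsupport χ ⊆ Icc a b := by
    rcases (tsupport χ).eq_empty_or_nonempty with h | h
    · exact ⟨0, -1, by norm_num, by norm_num, by simp [h]⟩
    · have hK : IsCompact (tsupport χ) := hc
      exact ⟨sInf (tsupport χ), sSup (tsupport χ), (hs (hK.sInf_mem h)).1, (hs (hK.sSup_mem h)).2,
        fun s hs => ⟨csInf_le hK.bddBelow hs, le_csSup hK.bddAbove hs⟩⟩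
  have hz : ∀ s, s ∉ Icc a b → χ s = 0 := fun s hs =>
    image_eq_zero_of_notMem_tsupport fun h => hs (hab h)
  have hlow : ∀ s, s < a → ∫ σ in (-1 : ℝ)..s, χ σ = 0 := fun s hsa =>
    intervalIntegral.integral_zero_ae (ae_of_all _ fun σ hσ => hz σ fun h => by
      have := hσ.2
      have := le_max_iff.1 this
      rcases this with h' | h' <;> linarith [h.1])
  have hhigh : ∀ s, b < s → ∫ σ in (-1 : ℝ)..s, χ σ = 0 := fun s hsb => by
    rw [← intervalIntegral.integral_add_adjacent_intervals
      (hχc.intervalIntegrable (-1) 0) (hχc.intervalIntegrable 0 s)]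
    have e1 : ∫ σ in (-1 : ℝ)..0, χ σ = 0 := by
      rw [intervalIntegral.integral_of_le (by norm_num), ← integral_Icc_eq_integral_Ioc]
      exact h0
    have e2 : ∫ σ in (0 : ℝ)..s, χ σ = 0 :=
      intervalIntegral.integral_zero_ae (ae_of_all _ fun σ hσ => hz σ fun h => by
        have := hσ.1
        have := min_lt_iff.1 this
        rcases this with h' | h' <;> linarith [h.2])
    rw [e1, e2, add_zero]
  have hsupp : tsupport (fun s => ∫ σ in (-1 : ℝ)..s, χ σ) ⊆ Icc a b := by
    refine closure_minimal (fun s hs => ?_) isClosed_Icc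
    by_contra h
    rw [mem_Icc, not_and_or, not_le, not_le] at h
    exact hs (h.elim (hlow s) (hhigh s))
  refine ⟨_, ?_, isCompact_Icc.of_isClosed_subset (isClosed_tsupport _) hsupp,
    hsupp.trans fun s h => ⟨by linarith [h.1], by linarith [h.2]⟩, hderiv⟩
  rw [contDiff_infty_iff_deriv, hderiv]
  exact ⟨fun s => (hd s).differentiableAt, hχ⟩

/-- **Du Bois-Reymond lemma**: a function with vanishing weak derivative is constant. -/
theorem HasWeakDeriv.ae_eq_const {f : HistLp X p} (h : HasWeakDeriv f 0) :
    ∃ c : X, f =ᵐ[histMeasure] fun _ => c := by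
  let β : ContDiffBump (-1 / 2 : ℝ) := ⟨1 / 8, 1 / 4, by norm_num, by norm_num⟩
  set ψ : ℝ → ℝ := β.normed volume with hψ
  have hψd : ContDiff ℝ ∞ ψ := β.contDiff_normed
  have hψc : HasCompactSupport ψ := β.hasCompactSupport_normed
  have hψs : tsupport ψ ⊆ Ioo (-1 : ℝ) 0 := by
    rw [hψ, β.tsupport_normed_eq, Real.closedBall_eq_Icc]
    intro s hs
    have h1 := hs.1
    have h2 := hs.2
    simp only [β] at h1 h2
    constructor <;> linarith
  have hfull : ∀ φ : ℝ → ℝ, tsupport φ ⊆ Ioo (-1 : ℝ) 0 → ∫ σ, φ σ ∂histMeasure = ∫ σ, φ σ :=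
    fun φ hs => setIntegral_eq_integral_of_forall_compl_eq_zero fun σ hσ =>
      testFunction_eq_zero hs fun h => hσ (Ioo_subset_Icc_self h)
  have hψ1 : ∫ σ, ψ σ ∂histMeasure = 1 := by
    rw [hfull ψ hψs]
    exact β.integral_normed
  have hzero : ∀ φ : ℝ → ℝ, ∫ σ, φ σ • (0 : HistLp X p) σ ∂histMeasure = 0 := fun φ => by
    refine integral_eq_zero_of_ae ?_
    filter_upwards [Lp.coeFn_zero X p histMeasure] with σ h
    rw [h, Pi.zero_apply, smul_zero]
  refine ⟨∫ σ, ψ σ • f σ ∂histMeasure, ?_⟩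
  set c := ∫ σ, ψ σ • f σ ∂histMeasure with hcdef
  have key := (isOpen_Ioo (a := (-1 : ℝ)) (b := 0)).ae_eq_zero_of_integral_contDiff_smul_eq_zero
    (μ := histMeasure) (f := fun σ => f σ - c)
    (((integrable_hist f).sub (integrable_const c)).locallyIntegrable.locallyIntegrableOn _) (by
      intro φ hφ hc hs
      set m := ∫ σ, φ σ ∂histMeasure with hm
      have hφi : Integrable φ histMeasure := integrable_hist_of_continuous hφ.continuous
      have hψi : Integrable ψ histMeasure := integrable_hist_of_continuous hψd.continuous
      have hχs : tsupport (fun σ => φ σ - m * ψ σ) ⊆ tsupport φ ∪ tsupport ψ := by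
        refine closure_minimal (fun s hs => ?_) ((isClosed_tsupport _).union (isClosed_tsupport _))
        by_contra hn
        rw [mem_union, not_or] at hn
        exact hs (by simp only [image_eq_zero_of_notMem_tsupport hn.1,
          image_eq_zero_of_notMem_tsupport hn.2, mul_zero, sub_zero])
      obtain ⟨θ, hθ, hθc, hθs, hθd⟩ := exists_testFunction_deriv_eq
        (χ := fun σ => φ σ - m * ψ σ) (hφ.sub (contDiff_const.mul hψd))
        ((IsCompact.union hc hψc).of_isClosed_subset (isClosed_tsupport _) hχs)
        (hχs.trans (union_subset hs hψs)) (by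
          rw [integral_sub hφi (hψi.const_mul m), integral_const_mul, hψ1, mul_one, sub_self])
      have e := h θ hθ hθc hθs
      rw [hzero, neg_zero, hθd] at e
      have e2 : ∀ σ, (φ σ - m * ψ σ) • f σ = φ σ • f σ - m • (ψ σ • f σ) := fun σ => by
        rw [sub_smul, mul_smul]
      have hψf : Integrable (fun σ => m • (ψ σ • f σ)) histMeasure :=
        (integrable_smul_hist f hψd.continuous hψc).smul m
      simp only [e2] at e
      rw [integral_sub (integrable_smul_hist f hφ.continuous hc) hψf, integral_smul,
        sub_eq_zero] at e
      simp only [smul_sub]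
      rw [integral_sub (integrable_smul_hist f hφ.continuous hc) (hφi.smul_const c),
        integral_smul_const, e, sub_self])
  have hIoo : ∀ᵐ σ ∂histMeasure, σ ∈ Ioo (-1 : ℝ) 0 := by
    rw [histMeasure, ← restrict_Ioo_eq_restrict_Icc]
    exact ae_restrict_mem measurableSet_Ioo
  filter_upwards [key, hIoo] with σ h hσ
  exact sub_eq_zero.1 (h hσ)

/-- A weakly differentiable function with value `x` at `0` is `x + ∫₀^σ f'`. -/
theorem LocLp.hist_prim_eq {u : ℝ → X} (hu : LocLp p u) {f : HistLp X p} {x : X}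
    (h : HasWeakDeriv f (hist p u 0)) (hx : HasValueAtZero f x) : hist p (prim x u) 0 = f := by
  have hP := hu.continuous_prim x
  have hPL : LocLp p (prim x u) := LocLp.of_continuous hP
  have hd : HasWeakDeriv (f + (-1 : ℝ) • hist p (prim x u) 0) 0 := by
    have := h.add ((hu.hasWeakDeriv_hist x 0).smul (-1 : ℝ))
    rwa [neg_one_smul ℝ (hist p u 0), add_neg_cancel] at this
  obtain ⟨c, hc⟩ := hd.ae_eq_const
  obtain ⟨F, hF, hfF, hF0⟩ := hx
  have hFP : (fun σ => F σ - prim x u σ) =ᵐ[histMeasure] fun _ => c := by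
    filter_upwards [hc, Lp.coeFn_add f ((-1 : ℝ) • hist p (prim x u) 0),
      Lp.coeFn_smul (-1 : ℝ) (hist p (prim x u) 0), hfF, hPL.coeFn_hist 0] with σ e1 e2 e3 e4 e5
    rw [← e1, e2, Pi.add_apply, e3, Pi.smul_apply, e4, e5, zero_add, neg_smul, one_smul,
      sub_eq_add_neg]
  have heq := Measure.eqOn_Icc_of_ae_eq volume (by norm_num : (-1 : ℝ) ≠ 0) hFP
    (hF.sub hP.continuousOn) continuousOn_const
  have hc0 : c = 0 := by
    have h0 : F 0 - prim x u 0 = c := heq (right_mem_Icc.2 (by norm_num))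
    rw [← h0, hF0, prim_zero, sub_self]
  refine hPL.hist_eq_of_ae ?_
  filter_upwards [hfF, ae_mem_histInterval] with σ e1 hσ
  rw [e1, zero_add, ← sub_eq_zero]
  exact (heq hσ).trans hc0

end Sobolev

/-! ### The unperturbed delay semigroup -/

section Unperturbed

variable {𝕜 X : Type*} [RCLike 𝕜] [NormedAddCommGroup X] [NormedSpace 𝕜 X] [NormedSpace ℝ X]
  [IsScalarTower ℝ 𝕜 X] [CompleteSpace X] {p : ℝ≥0∞} [Fact (1 ≤ p)]

theorem hasDerivWithinAt_toLp {a : ℝ → X} {b : ℝ → HistLp X p} {a' : X} {b' : HistLp X p}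
    {s : Set ℝ} {t : ℝ} (ha : HasDerivWithinAt a a' s t) (hb : HasDerivWithinAt b b' s t) :
    HasDerivWithinAt (fun t => (WithLp.toLp 1 (a t, b t) : StateSpace X p))
      (WithLp.toLp 1 (a', b')) s t :=
  (WithLp.prodContinuousLinearEquiv 1 ℝ X (HistLp X p)).symm.toContinuousLinearMap.hasFDerivAt
    |>.comp_hasDerivWithinAt t (ha.prodMk hb)

/-- The function that equals `c` on `(0, ∞)`, the class `f` on `[-1, 0]`, and `0` before. -/
noncomputable def glue (c : ℝ → X) (f : HistLp X p) (t : ℝ) : X :=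
  (Ioi (0 : ℝ)).indicator c t + (Icc (-1 : ℝ) 0).indicator f t

theorem glue_of_pos (c : ℝ → X) (f : HistLp X p) {t : ℝ} (ht : 0 < t) : glue c f t = c t := by
  rw [glue, indicator_of_mem (mem_Ioi.2 ht), indicator_of_notMem fun h => ht.not_ge h.2, add_zero]

theorem glue_of_mem (c : ℝ → X) (f : HistLp X p) {t : ℝ} (ht : t ∈ Icc (-1 : ℝ) 0) :
    glue c f t = f t := by
  rw [glue, indicator_of_notMem (s := Ioi (0 : ℝ)) (fun h => ht.2.not_gt h), indicator_of_mem ht,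
    zero_add]

theorem locLp_glue {c : ℝ → X} (hc : Continuous c) (f : HistLp X p) : LocLp p (glue c f) :=
  fun a b => ((LocLp.of_continuous hc a b).indicator measurableSet_Ioi).add
    (((memLp_indicator_iff_restrict measurableSet_Icc).2 (Lp.memLp f)).restrict _)

theorem hist_glue_zero {c : ℝ → X} (hc : Continuous c) (f : HistLp X p) :
    hist p (glue c f) 0 = f := by
  refine (locLp_glue hc f).hist_eq_of_ae ?_
  filter_upwards [ae_mem_histInterval] with σ hσ
  rw [zero_add, glue_of_mem c f hσ]

theorem prim_glue (x : X) (c : ℝ → X) (f : HistLp X p) {t : ℝ} (ht : 0 ≤ t) :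
    prim x (glue c f) t = x + ∫ s in (0 : ℝ)..t, c s := by
  rw [prim]
  congr 1
  refine intervalIntegral.integral_congr_ae (ae_of_all _ fun s hs => ?_)
  rw [uIoc_of_le ht] at hs
  exact glue_of_pos c f hs.1

/-- The curve `t ↦ S(t) x` for `t > 0` and `t ↦ f(t)` for `t ∈ [-1, 0]`, whose segments are the
second components of the unperturbed delay semigroup. -/
noncomputable def delayCurve (S : C0Semigroup 𝕜 X) (ξ : StateSpace X p) : ℝ → X :=
  glue (fun t => S.toFun (max t 0) ξ.fst) ξ.snd

variable (S : C0Semigroup 𝕜 X)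

theorem delayCurve_of_pos (ξ : StateSpace X p) {t : ℝ} (ht : 0 < t) :
    delayCurve S ξ t = S.toFun t ξ.fst := by
  rw [delayCurve, glue_of_pos _ _ ht, max_eq_left ht.le]

theorem delayCurve_of_mem (ξ : StateSpace X p) {t : ℝ} (ht : t ∈ Icc (-1 : ℝ) 0) :
    delayCurve S ξ t = ξ.snd t := glue_of_mem _ _ ht

theorem locLp_delayCurve (ξ : StateSpace X p) : LocLp p (delayCurve S ξ) :=
  locLp_glue (S.isCont_normalize ξ.fst) ξ.snd

theorem hist_delayCurve_zero (ξ : StateSpace X p) : hist p (delayCurve S ξ) 0 = ξ.snd :=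
  hist_glue_zero (S.isCont_normalize ξ.fst) ξ.snd

theorem coeFn_orbitSegment (r : ℝ) (x : X) : orbitSegment p S r x =ᵐ[histMeasure]
    fun τ => (Ioc (-r) 0).indicator (fun τ => S.toFun (r + τ) x) τ :=
  MemLp.coeFn_toLp _

theorem coeFn_leftShift (r : ℝ) (f : HistLp X p) : leftShift r f =ᵐ[histMeasure]
    fun τ => (Icc (-1 : ℝ) 0).indicator f (r + τ) :=
  MemLp.coeFn_toLp _

/-- The segments of `delayCurve` are the functions `S_r x + T₀(r) f`. -/
theorem hist_delayCurve (ξ : StateSpace X p) (r : ℝ) :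
    hist p (delayCurve S ξ) r = orbitSegment p S r ξ.fst + leftShift r ξ.snd := by
  refine (locLp_delayCurve S ξ).hist_eq_of_ae ?_
  filter_upwards [Lp.coeFn_add (orbitSegment p S r ξ.fst) (leftShift r ξ.snd),
    coeFn_orbitSegment (p := p) S r ξ.fst, coeFn_leftShift r ξ.snd, ae_mem_histInterval]
    with σ e1 e2 e3 hσ
  rw [e1, Pi.add_apply, e2, e3, delayCurve, glue]
  congr 1
  by_cases h : 0 < r + σ
  · have hm : σ ∈ Ioc (-r) 0 := ⟨by linarith, hσ.2⟩
    rw [indicator_of_mem (mem_Ioi.2 h), indicator_of_mem hm, max_eq_left h.le]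
  · have hm : σ ∉ Ioc (-r) 0 := fun h' => h (by linarith [h'.1])
    rw [indicator_of_notMem (s := Ioi (0 : ℝ)) h, indicator_of_notMem hm]

theorem leftShift_congr_ae {f : HistLp X p} {g : ℝ → X} (h : f =ᵐ[histMeasure] g) (r : ℝ) :
    leftShift r f =ᵐ[histMeasure] fun τ => (Icc (-1 : ℝ) 0).indicator g (r + τ) := by
  have h1 := ae_eq_restrict_iff_indicator_ae_eq (measurableSet_Icc) |>.1 h
  have h2 : ∀ᵐ τ, (Icc (-1 : ℝ) 0).indicator f (r + τ) = (Icc (-1 : ℝ) 0).indicator g (r + τ) :=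
    (measurePreserving_add_left volume r).quasiMeasurePreserving.ae h1
  filter_upwards [coeFn_leftShift r f, ae_restrict_of_ae h2] with τ e1 e2
  rw [e1, e2]

theorem norm_leftShift_le (r : ℝ) (f : HistLp X p) : ‖leftShift r f‖ ≤ ‖f‖ := by
  have hm : AEStronglyMeasurable ((Icc (-1 : ℝ) 0).indicator f) volume :=
    (aestronglyMeasurable_indicator_iff measurableSet_Icc).2 (Lp.aestronglyMeasurable f)
  rw [leftShift, Lp.norm_toLp, Lp.norm_def]
  refine ENNReal.toReal_mono (Lp.eLpNorm_ne_top f) ?_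
  refine (eLpNorm_mono_measure _ Measure.restrict_le_self).trans ?_
  have := eLpNorm_comp_measurePreserving (p := p) hm (measurePreserving_add_left volume r)
  rw [Function.comp_def] at this
  rw [this, eLpNorm_indicator_eq_eLpNorm_restrict measurableSet_Icc]

theorem exists_norm_orbitSegment_le (r : ℝ) :
    ∃ C : ℝ, 0 ≤ C ∧ ∀ x, ‖orbitSegment p S r x‖ ≤ C * ‖x‖ := by
  obtain ⟨C, hC0, hC⟩ := S.exists_bound r
  refine ⟨C, hC0, fun x => ?_⟩
  have : ∀ᵐ τ ∂histMeasure, ‖orbitSegment p S r x τ‖ ≤ C * ‖x‖ := by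
    filter_upwards [coeFn_orbitSegment (p := p) S r x] with τ e
    rw [e]
    by_cases h : τ ∈ Ioc (-r) 0
    · rw [indicator_of_mem h]
      exact (S.toFun (r + τ)).le_of_opNorm_le (hC _ ⟨by linarith [h.1], by linarith [h.2]⟩) x
    · rw [indicator_of_notMem h, norm_zero]
      positivity
  have h1 : measureUnivNNReal histMeasure = 1 := by
    rw [← ENNReal.coe_inj, coe_measureUnivNNReal, measure_univ, ENNReal.coe_one]
  simpa [h1] using Lp.norm_le_of_ae_bound (by positivity) this

theorem orbitSegment_add (r : ℝ) (x y : X) :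
    orbitSegment p S r (x + y) = orbitSegment p S r x + orbitSegment p S r y := by
  refine Lp.ext ?_
  filter_upwards [coeFn_orbitSegment (p := p) S r (x + y), coeFn_orbitSegment (p := p) S r x,
    coeFn_orbitSegment (p := p) S r y,
    Lp.coeFn_add (orbitSegment p S r x) (orbitSegment p S r y)] with τ e1 e2 e3 e4
  rw [e1, e4, Pi.add_apply, e2, e3]
  by_cases h : τ ∈ Ioc (-r) 0 <;> simp [h]

theorem orbitSegment_smul (r : ℝ) (c : 𝕜) (x : X) :
    orbitSegment p S r (c • x) = c • orbitSegment p S r x := by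
  refine Lp.ext ?_
  filter_upwards [coeFn_orbitSegment (p := p) S r (c • x), coeFn_orbitSegment (p := p) S r x,
    Lp.coeFn_smul c (orbitSegment p S r x)] with τ e1 e2 e3
  rw [e1, e3, Pi.smul_apply, e2]
  by_cases h : τ ∈ Ioc (-r) 0 <;> simp [h]

theorem leftShift_add (r : ℝ) (f g : HistLp X p) :
    leftShift r (f + g) = leftShift r f + leftShift r g := by
  refine Lp.ext ?_
  filter_upwards [leftShift_congr_ae (Lp.coeFn_add f g) r, coeFn_leftShift r f,
    coeFn_leftShift r g, Lp.coeFn_add (leftShift r f) (leftShift r g)] with τ e1 e2 e3 e4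
  rw [e1, e4, Pi.add_apply, e2, e3]
  by_cases h : r + τ ∈ Icc (-1 : ℝ) 0 <;> simp only [h, indicator_of_mem, indicator_of_notMem,
    Pi.add_apply, not_false_eq_true, add_zero]

theorem leftShift_smul (r : ℝ) (c : 𝕜) (f : HistLp X p) :
    leftShift r (c • f) = c • leftShift r f := by
  refine Lp.ext ?_
  filter_upwards [leftShift_congr_ae (Lp.coeFn_smul c f) r, coeFn_leftShift r f,
    Lp.coeFn_smul c (leftShift r f)] with τ e1 e2 e3
  rw [e1, e3, Pi.smul_apply, e2]
  by_cases h : r + τ ∈ Icc (-1 : ℝ) 0 <;> simp only [h, indicator_of_mem, indicator_of_notMem,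
    Pi.smul_apply, not_false_eq_true, smul_zero]

variable (p) in
/-- The operator `(x, f) ↦ (S(t) x, S_t x + T₀(t) f)` for `t ≥ 0`, constant in `t ≤ 0`. -/
noncomputable def delayMap (t : ℝ) : StateSpace X p →L[𝕜] StateSpace X p :=
  LinearMap.mkContinuousOfExistsBound
    { toFun := fun ξ => WithLp.toLp 1 (S.toFun (max t 0) ξ.fst,
        orbitSegment p S (max t 0) ξ.fst + leftShift (max t 0) ξ.snd)
      map_add' := fun ξ η => by
        exact congrArg (WithLp.toLp 1) (Prod.ext ((S.toFun (max t 0)).map_add ξ.fst η.fst)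
          ((congrArg₂ (· + ·) (orbitSegment_add S (max t 0) ξ.fst η.fst)
            (leftShift_add (max t 0) ξ.snd η.snd)).trans (add_add_add_comm _ _ _ _)))
      map_smul' := fun c ξ => by
        exact congrArg (WithLp.toLp 1) (Prod.ext ((S.toFun (max t 0)).map_smul c ξ.fst)
          ((congrArg₂ (· + ·) (orbitSegment_smul S (max t 0) c ξ.fst)
            (leftShift_smul (max t 0) c ξ.snd)).trans (smul_add _ _ _).symm)) } (by
    obtain ⟨C, hC0, hC⟩ := exists_norm_orbitSegment_le (p := p) S (max t 0)
    refine ⟨‖S.toFun (max t 0)‖ + C + 1, fun ξ => ?_⟩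
    have h1 : ‖ξ.fst‖ ≤ ‖ξ‖ := by
      rw [WithLp.prod_norm_eq_of_L1 ξ]; exact le_add_of_nonneg_right (norm_nonneg _)
    have h2 : ‖ξ.snd‖ ≤ ‖ξ‖ := by
      rw [WithLp.prod_norm_eq_of_L1 ξ]; exact le_add_of_nonneg_left (norm_nonneg _)
    calc ‖(WithLp.toLp 1 (S.toFun (max t 0) ξ.fst,
          orbitSegment p S (max t 0) ξ.fst + leftShift (max t 0) ξ.snd) : StateSpace X p)‖
        = ‖S.toFun (max t 0) ξ.fst‖
          + ‖orbitSegment p S (max t 0) ξ.fst + leftShift (max t 0) ξ.snd‖ :=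
          WithLp.prod_norm_eq_of_L1 _
      _ ≤ ‖S.toFun (max t 0)‖ * ‖ξ‖ + (C * ‖ξ‖ + ‖ξ‖) := by
          refine add_le_add (((S.toFun (max t 0)).le_opNorm _).trans (by gcongr))
            ((norm_add_le _ _).trans (add_le_add ((hC _).trans (by gcongr))
              ((norm_leftShift_le _ _).trans h2)))
      _ = (‖S.toFun (max t 0)‖ + C + 1) * ‖ξ‖ := by ring)

theorem delayMap_apply {t : ℝ} (ht : 0 ≤ t) (ξ : StateSpace X p) :
    delayMap p S t ξ = WithLp.toLp 1 (S.toFun t ξ.fst, hist p (delayCurve S ξ) t) := by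
  rw [hist_delayCurve S ξ]
  change WithLp.toLp 1 (S.toFun (max t 0) ξ.fst,
        orbitSegment p S (max t 0) ξ.fst + leftShift (max t 0) ξ.snd) = _
  rw [max_eq_left ht]

theorem delayMap_max (t : ℝ) : delayMap p S t = delayMap p S (max t 0) := by
  ext1 ξ
  rw [delayMap_apply S (le_max_right t 0), hist_delayCurve S ξ]
  rfl

/-- Restarting the curve at time `t` from the state at time `t` continues the original curve. -/
theorem delayCurve_delayMap {t : ℝ} (ht : 0 ≤ t) (ξ : StateSpace X p) :
    ∀ᵐ r : ℝ, -1 ≤ r → delayCurve S (delayMap p S t ξ) r = delayCurve S ξ (t + r) := by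
  have h1 := (ae_restrict_iff' (measurableSet_Icc)).1 ((locLp_delayCurve S ξ).coeFn_hist t)
  filter_upwards [h1] with r hr hr1
  rcases le_or_gt r 0 with h | h
  · rw [delayCurve_of_mem S _ ⟨hr1, h⟩, delayMap_apply S ht]
    exact hr ⟨hr1, h⟩
  · rw [delayCurve_of_pos S _ h, delayCurve_of_pos S _ (by positivity), delayMap_apply S ht,
      add_comm t r, S.apply_add h.le ht, WithLp.toLp_fst]

theorem hist_congr_of_ae {u v : ℝ → X} (hu : LocLp p u) (hv : LocLp p v) {s t : ℝ} (hs : 0 ≤ s)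
    (h : ∀ᵐ r : ℝ, -1 ≤ r → u r = v (t + r)) : hist p u s = hist p v (t + s) := by
  refine hu.hist_eq_of_ae ((hv.coeFn_hist (t + s)).trans ?_)
  have h2 := ae_hist_of_ae (t := s) (ae_restrict_of_ae h)
  filter_upwards [h2, ae_mem_histInterval] with σ hσ hσ1
  rw [hσ (by linarith [hσ1.1]), add_assoc]

theorem continuous_delayMap (hp : p ≠ ⊤) (ξ : StateSpace X p) :
    Continuous fun t => delayMap p S t ξ := by
  have e : (fun t => delayMap p S t ξ) = fun t => WithLp.toLp 1 (S.toFun (max t 0) ξ.fst,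
      hist p (delayCurve S ξ) (max t 0)) := by
    ext1 t
    rw [delayMap_max, delayMap_apply S (le_max_right t 0)]
  rw [e]
  have h1 : Continuous fun t => S.toFun (max t 0) ξ.fst := S.isCont_normalize ξ.fst
  have h2 := ((locLp_delayCurve S ξ).continuous_hist hp).comp
    (continuous_id.max continuous_const : Continuous fun t : ℝ => max t 0)
  exact (WithLp.prod_continuous_toLp 1 X (HistLp X p)).comp (h1.prodMk h2)

/-- The unperturbed delay semigroup `(x, f) ↦ (S(t) x, S_t x + T₀(t) f)`. -/
noncomputable def delaySemigroup (hp : p ≠ ⊤) : C0Semigroup 𝕜 (StateSpace X p) where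
  toFun := delayMap p S
  map_zero := by
    ext1 ξ
    rw [delayMap_apply S le_rfl, hist_delayCurve_zero, S.apply_zero]
    rfl
  map_add s t hs ht := by
    ext1 ξ
    rw [ContinuousLinearMap.comp_apply, delayMap_apply S (add_nonneg hs ht), delayMap_apply S hs,
      hist_congr_of_ae (locLp_delayCurve S _) (locLp_delayCurve S ξ) hs
        (delayCurve_delayMap S ht ξ), delayMap_apply S ht, S.apply_add hs ht, add_comm t s]
    rfl
  continuousOn_orbit ξ := (continuous_delayMap S hp ξ).continuousOn

theorem isCont_delaySemigroup (hp : p ≠ ⊤) : (delaySemigroup (p := p) S hp).IsCont :=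
  continuous_delayMap S hp

theorem delaySemigroup_apply (hp : p ≠ ⊤) {t : ℝ} (ht : 0 ≤ t) (ξ : StateSpace X p) :
    (delaySemigroup S hp).toFun t ξ =
      WithLp.toLp 1 (S.toFun t ξ.fst, hist p (delayCurve S ξ) t) :=
  delayMap_apply S ht ξ

variable {S}

/-- If `A x = y` then the primitive through `x` of the curve of `(y, g)` is `S(t) x` for
`t ≥ 0`. -/
theorem prim_delayCurve {x y : X} (h : S.GenRel x y) (g : HistLp X p) {t : ℝ} (ht : 0 ≤ t) :
    prim x (delayCurve S (WithLp.toLp 1 (y, g) : StateSpace X p)) t = S.toFun t x := by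
  have h1 := ((S.genRel_normalize).2 h).integral_eq S.isCont_normalize ht
  rw [S.normalize_apply ht] at h1
  rw [delayCurve, prim_glue _ _ _ ht]
  change x + ∫ s in (0 : ℝ)..t, S.normalize.toFun s y = _
  rw [h1, add_sub_cancel]

/-- The generator of the unperturbed delay semigroup is `(x, f) ↦ (A x, f')` with the domain
`{(x, f) ∈ D(A) × W^{1,p} : f(0) = x}`. -/
theorem genRel_delaySemigroup_iff (hp : p ≠ ⊤) (ξ η : StateSpace X p) :
    (delaySemigroup S hp).GenRel ξ η ↔ S.GenRel ξ.fst η.fst ∧ HasWeakDeriv ξ.snd η.snd ∧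
      HasValueAtZero ξ.snd ξ.fst := by
  set u := delayCurve S η with hu_def
  have hu : LocLp p u := locLp_delayCurve S η
  have hu0 : hist p u 0 = η.snd := hist_delayCurve_zero S η
  set P := prim ξ.fst u with hP_def
  have hPL : LocLp p P := LocLp.of_continuous (hu.continuous_prim _)
  -- Once `A x = y` is known, everything says that `f` is the segment at `0` of the primitive `P`.
  have hPS : S.GenRel ξ.fst η.fst → ∀ t, 0 ≤ t → P t = S.toFun t ξ.fst := fun h t ht =>
    prim_delayCurve h η.snd ht
  constructor
  · intro h
    have h1 : S.GenRel ξ.fst η.fst := by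
      refine (((WithLp.fstL 1 𝕜 X (HistLp X p)).continuous.tendsto η).comp h).congr' ?_
      filter_upwards [self_mem_nhdsWithin] with t ht
      rw [Function.comp_apply, delaySemigroup_apply S hp (le_of_lt ht)]
      rfl
    have h2 := congrArg (WithLp.sndL 1 𝕜 X (HistLp X p))
      (h.integral_eq (isCont_delaySemigroup S hp) zero_le_one)
    rw [← ContinuousLinearMap.intervalIntegral_comp_comm _
      (C0Semigroup.intervalIntegrable (isCont_delaySemigroup S hp) _ _ _)] at h2
    have h3 : ∫ s in (0 : ℝ)..1, WithLp.sndL 1 𝕜 X (HistLp X p)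
        ((delaySemigroup S hp).toFun s η) = ∫ s in (0 : ℝ)..1, hist p u s := by
      refine intervalIntegral.integral_congr fun s hs => ?_
      rw [uIcc_of_le zero_le_one] at hs
      simp only [delaySemigroup_apply S hp hs.1]
      rfl
    rw [h3, hu.integral_hist hp ξ.fst, delaySemigroup_apply S hp zero_le_one] at h2
    have h4 : hist p P 1 = hist p (delayCurve S ξ) 1 := by
      refine hPL.hist_eq_of_ae (((locLp_delayCurve S ξ).coeFn_hist 1).trans ?_)
      have : ∀ᵐ σ ∂histMeasure, σ ≠ -1 := ae_restrict_of_ae (Measure.ae_ne volume (-1))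
      filter_upwards [ae_mem_histInterval, this] with σ hσ hσ1
      have : 0 < 1 + σ := by
        have := lt_of_le_of_ne hσ.1 hσ1.symm
        linarith
      rw [delayCurve_of_pos S _ this, hPS h1 _ this.le]
    have h5 : hist p P 1 - hist p P 0 = hist p (delayCurve S ξ) 1 - ξ.snd := h2
    have h6 : ξ.snd = hist p P 0 := by
      rw [h4] at h5
      exact (sub_right_injective h5).symm
    refine ⟨h1, ?_, ?_⟩
    · rw [h6, ← hu0]
      exact hu.hasWeakDeriv_hist _ _
    · have := hu.hasValueAtZero_hist ξ.fst 0
      rwa [prim_zero, ← hP_def, ← h6] at this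
  · rintro ⟨h1, h2, h3⟩
    have h4 : hist p P 0 = ξ.snd := hu.hist_prim_eq (hu0 ▸ h2) h3
    have h5 : ∀ t, 0 ≤ t → hist p (delayCurve S ξ) t = hist p P t := fun t ht => by
      have := hist_congr_of_ae (s := t) (t := 0) (locLp_delayCurve S ξ) hPL ht (by
        have h6 := hPL.coeFn_hist 0
        rw [h4] at h6
        filter_upwards [(ae_restrict_iff' measurableSet_Icc).1 h6] with r hr hr1
        rcases le_or_gt r 0 with h | h
        · rw [delayCurve_of_mem S _ ⟨hr1, h⟩, hr ⟨hr1, h⟩]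
        · rw [delayCurve_of_pos S _ h, zero_add, hPS h1 _ h.le])
      rwa [zero_add] at this
    rw [C0Semigroup.genRel_iff_hasDerivWithinAt]
    have h7 : HasDerivWithinAt (fun t => (WithLp.toLp 1 (S.toFun t ξ.fst, hist p P t) :
        StateSpace X p)) (WithLp.toLp 1 (η.fst, hist p u 0)) (Ioi 0) 0 :=
      hasDerivWithinAt_toLp (C0Semigroup.genRel_iff_hasDerivWithinAt.1 h1)
        (hu.hasDerivAt_hist hp ξ.fst 0).hasDerivWithinAt
    rw [hu0] at h7
    refine h7.congr (fun t ht => ?_) ?_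
    · rw [delaySemigroup_apply S hp (le_of_lt ht), h5 t (le_of_lt ht)]
    · rw [delaySemigroup_apply S hp le_rfl, h5 0 le_rfl]

end Unperturbed

section Delay

variable {𝕜 X : Type*} [RCLike 𝕜] [NormedAddCommGroup X] [NormedSpace 𝕜 X] [NormedSpace ℝ X]
  [IsScalarTower ℝ 𝕜 X] [CompleteSpace X] {p : ℝ≥0∞} [Fact (1 ≤ p)]

/-! ### The delay operator is a generator -/

theorem norm_snd_le (ξ : StateSpace X p) : ‖ξ.snd‖ ≤ ‖ξ‖ := by
  rw [WithLp.prod_norm_eq_of_L1 ξ]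
  exact le_add_of_nonneg_left (norm_nonneg _)

theorem norm_fst_le (ξ : StateSpace X p) : ‖ξ.fst‖ ≤ ‖ξ‖ := by
  rw [WithLp.prod_norm_eq_of_L1 ξ]
  exact le_add_of_nonneg_right (norm_nonneg _)

theorem mem_graph_delayOp_iff {A : X →ₗ.[𝕜] X} {Φ : sobolev 𝕜 X p →ₗ[𝕜] X}
    {ξ θ : StateSpace X p} : (ξ, θ) ∈ (delayOp A Φ).graph ↔
      ∃ (hx : ξ.fst ∈ A.domain) (hf : ξ.snd ∈ sobolev 𝕜 X p), HasValueAtZero ξ.snd ξ.fst ∧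
        HasWeakDeriv ξ.snd θ.snd ∧ θ.fst = A ⟨ξ.fst, hx⟩ + Φ ⟨ξ.snd, hf⟩ := by
  rw [LinearPMap.mem_graph_iff]
  constructor
  · rintro ⟨⟨ζ, h1, h2, h3⟩, rfl, rfl⟩
    exact ⟨h1, h2, h3, hasWeakDeriv_weakDeriv ⟨ζ.snd, h2⟩, rfl⟩
  · rintro ⟨h1, h2, h3, h4, h5⟩
    have h6 : weakDeriv 𝕜 X p ⟨ξ.snd, h2⟩ = θ.snd :=
      (hasWeakDeriv_weakDeriv ⟨ξ.snd, h2⟩).unique h4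
    refine ⟨⟨ξ, h1, h2, h3⟩, rfl, ?_⟩
    change WithLp.toLp 1 (A ⟨ξ.fst, h1⟩ + Φ ⟨ξ.snd, h2⟩, weakDeriv 𝕜 X p ⟨ξ.snd, h2⟩) = θ
    rw [h6, ← h5]
    rfl

/-- The perturbation `(x, f) ↦ (Ψ f, 0)`. -/
noncomputable def delayPerturbation (Ψ : HistLp X p →ₗ[𝕜] X) :
    StateSpace X p →ₗ[𝕜] StateSpace X p :=
  (WithLp.linearEquiv 1 𝕜 (X × HistLp X p)).symm.toLinearMap ∘ₗ
    LinearMap.inl 𝕜 X (HistLp X p) ∘ₗ Ψ ∘ₗ (WithLp.sndL 1 𝕜 X (HistLp X p)).toLinearMap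

theorem delayPerturbation_apply (Ψ : HistLp X p →ₗ[𝕜] X) (ξ : StateSpace X p) :
    delayPerturbation Ψ ξ = WithLp.toLp 1 (Ψ ξ.snd, 0) := rfl

theorem norm_delayPerturbation (Ψ : HistLp X p →ₗ[𝕜] X) (ξ : StateSpace X p) :
    ‖delayPerturbation Ψ ξ‖ = ‖Ψ ξ.snd‖ := by
  rw [delayPerturbation_apply, WithLp.prod_norm_eq_of_L1]
  simp

/-- The delay operator is a Miyadera perturbation of the unperturbed delay operator. -/
theorem exists_hasGenerator_delayOp (hp : p ≠ ⊤) {A : X →ₗ.[𝕜] X} {S : C0Semigroup 𝕜 X}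
    (hA : S.HasGenerator A) {Φ : sobolev 𝕜 X p →ₗ[𝕜] X} (hΦ : SobolevBounded Φ)
    (hM : ConditionM A S Φ) :
    ∃ W : C0Semigroup 𝕜 (StateSpace X p), W.IsCont ∧ W.HasGenerator (delayOp A Φ) := by
  obtain ⟨Ψ, hΨ⟩ := LinearMap.exists_extend Φ
  have hΨΦ : ∀ f (hf : f ∈ sobolev 𝕜 X p), Ψ f = Φ ⟨f, hf⟩ := fun f hf =>
    LinearMap.congr_fun hΨ ⟨f, hf⟩
  set T := delaySemigroup (p := p) S hp with hT_def
  have hT : T.IsCont := isCont_delaySemigroup S hp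
  have hN : ∀ t, T.toFun t = T.toFun (max t 0) := delayMap_max S
  have hsob : ∀ {ξ η : StateSpace X p}, T.GenRel ξ η → ξ.snd ∈ sobolev 𝕜 X p := fun h =>
    ⟨_, ((genRel_delaySemigroup_iff hp _ _).1 h).2.1⟩
  have hB : GraphBounded T (delayPerturbation Ψ) := by
    obtain ⟨C, hC⟩ := hΦ
    refine ⟨|C|, fun ξ η h => ?_⟩
    have hw := ((genRel_delaySemigroup_iff hp _ _).1 h).2.1
    have h1 := hC ⟨ξ.snd, hsob h⟩
    rw [(hasWeakDeriv_weakDeriv ⟨ξ.snd, hsob h⟩).unique hw, ← hΨΦ] at h1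
    rw [norm_delayPerturbation]
    refine h1.trans ?_
    gcongr
    · exact le_abs_self C
    · exact norm_snd_le ξ
    · exact norm_snd_le η
  obtain ⟨t₀, q, ht₀, hq, hq1, hM⟩ := hM
  have hM' : ∀ ξ η, T.GenRel ξ η →
      ∫ r in (0 : ℝ)..t₀, ‖delayPerturbation Ψ (T.toFun r ξ)‖ ≤ q * ‖ξ‖ := by
    intro ξ η h
    obtain ⟨h1, h2, h3⟩ := (genRel_delaySemigroup_iff hp _ _).1 h
    refine le_trans (le_of_eq ?_)
      (hM ξ ⟨LinearPMap.mem_domain_of_mem_graph ((hA _ _).2 h1), ⟨_, h2⟩, h3⟩)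
    refine intervalIntegral.integral_congr fun r hr => ?_
    rw [uIcc_of_le ht₀.le] at hr
    have h4 : (T.toFun r ξ).snd = orbitSegment p S r ξ.fst + leftShift r ξ.snd := by
      rw [hT_def, delaySemigroup_apply S hp hr.1]
      exact hist_delayCurve S ξ r
    have h5 := hsob (h.map hr.1)
    simp only [norm_delayPerturbation]
    rw [h4] at h5 ⊢
    rw [normPhi, dif_pos h5, hΨΦ _ h5]
  obtain ⟨W, hW, hgen⟩ := exists_miyadera_semigroup hN hT hB ht₀ hq hq1 hM'
  refine ⟨W, hW, fun ξ θ => Iff.trans ?_ (hgen ξ θ).symm⟩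
  rw [mem_graph_delayOp_iff]
  constructor
  · rintro ⟨hx, hf, hv, hw, e⟩
    refine ⟨WithLp.toLp 1 (A ⟨ξ.fst, hx⟩, θ.snd), (genRel_delaySemigroup_iff hp _ _).2
      ⟨(hA _ _).1 (LinearPMap.mem_graph A ⟨ξ.fst, hx⟩), hw, hv⟩, ?_⟩
    rw [delayPerturbation_apply, ← WithLp.toLp_add, Prod.mk_add_mk, add_zero, hΨΦ _ hf, ← e]
    rfl
  · rintro ⟨η, hη, rfl⟩
    obtain ⟨h1, h2, h3⟩ := (genRel_delaySemigroup_iff hp _ _).1 hη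
    obtain ⟨⟨x, hx⟩, rfl, h5⟩ := LinearPMap.mem_graph_iff _ |>.1 ((hA _ _).2 h1)
    refine ⟨hx, hsob hη, h3, ?_, ?_⟩
    · have : (η + delayPerturbation Ψ ξ).snd = η.snd := add_zero η.snd
      rwa [this]
    · rw [h5, ← hΨΦ ξ.snd (hsob hη)]
      rfl

/-! ### Well-posedness -/

theorem genRel_iff_mem_graph {W : C0Semigroup 𝕜 (StateSpace X p)}
    {G : StateSpace X p →ₗ.[𝕜] StateSpace X p} (hW : W.HasGenerator G) {ξ θ : StateSpace X p} :
    W.GenRel ξ θ ↔ (ξ, θ) ∈ G.graph := (hW ξ θ).symm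

/-- A weakly differentiable history `f` with `f(0) = x` is the segment at `0` of the primitive
through `x` of any curve glued from `f'` and a continuous function. -/
theorem hist_prim_glue_zero {c : ℝ → X} (hc : Continuous c) {f f' : HistLp X p} {x : X}
    (hf : HasWeakDeriv f f') (hx : HasValueAtZero f x) :
    hist p (prim x (glue c f')) 0 = f :=
  (locLp_glue hc f').hist_prim_eq (by rwa [hist_glue_zero hc f']) hx

/-- Right derivative of the state `(U(t), U_t)` along a curve `U` glued from a history with weak
derivative `f'` and a `C¹` curve with derivative `c`. -/
theorem hasDerivWithinAt_state (hp : p ≠ ⊤) {c : ℝ → X} (hc : Continuous c) (f' : HistLp X p)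
    (x : X) {t : ℝ} (ht : 0 ≤ t) :
    HasDerivWithinAt (fun t => (WithLp.toLp 1 (prim x (glue c f') t,
      hist p (prim x (glue c f')) t) : StateSpace X p))
      (WithLp.toLp 1 (c t, hist p (glue c f') t)) (Ioi t) t := by
  have h1 : HasDerivAt (fun t => x + ∫ s in (0 : ℝ)..t, c s) (c t) t :=
    (intervalIntegral.integral_hasDerivAt_right (hc.intervalIntegrable _ _)
      (hc.stronglyMeasurableAtFilter _ _) hc.continuousAt).const_add x
  refine hasDerivWithinAt_toLp (h1.hasDerivWithinAt.congr (fun s hs => ?_) (prim_glue x c f' ht))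
    ((locLp_glue hc f').hasDerivAt_hist hp x t).hasDerivWithinAt
  exact prim_glue x c f' (ht.trans (le_of_lt hs))

/-- A classical solution of the delay equation is the first component of the orbit of the
perturbed semigroup, since `t ↦ (u(t), u_t)` solves the abstract Cauchy problem. -/
theorem IsSolution.eq_orbit (hp : p ≠ ⊤) {A : X →ₗ.[𝕜] X} {Φ : sobolev 𝕜 X p →ₗ[𝕜] X}
    {W : C0Semigroup 𝕜 (StateSpace X p)} (hWc : W.IsCont) (hW : W.HasGenerator (delayOp A Φ))
    {ξ : StateSpace X p} (hξ : ξ ∈ delayDomain p A) {v : ℝ → X}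
    (hv : IsSolution A Φ ξ.fst ξ.snd v) {t : ℝ} (ht : 0 ≤ t) : v t = (W.toFun t ξ).fst := by
  obtain ⟨hvc, hv1, hveq, hv0, hvf⟩ := hv
  obtain ⟨_, ⟨f', hf'⟩, hx⟩ := hξ
  obtain ⟨hvd, hvdc⟩ := (contDiffOn_one_iff_derivWithin (uniqueDiffOn_Ici 0)).1 hv1
  let c : ℝ → X := fun t => derivWithin v (Ici 0) (max t 0)
  have hc : Continuous c :=
    hvdc.comp_continuous (by fun_prop) fun t => le_max_right t 0
  set P := prim ξ.fst (glue c f') with hP_def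
  have hg : LocLp p (glue c f') := locLp_glue hc f'
  have hPc : Continuous P := hg.continuous_prim _
  have hPv : ∀ t, 0 ≤ t → P t = v t := by
    intro t ht
    have := intervalIntegral.integral_eq_sub_of_hasDeriv_right (a := 0) (b := t) (f := v)
      (f' := c) (hvc.mono fun s hs => by
        rw [uIcc_of_le ht] at hs
        exact (by norm_num : (-1 : ℝ) ≤ 0).trans hs.1) (fun s hs => by
        rw [min_eq_left ht] at hs
        have h1 := (hvd s hs.1.le).hasDerivWithinAt
        simp only [c, max_eq_left hs.1.le]
        exact h1.mono fun r hr => hs.1.le.trans (le_of_lt hr)) (hc.intervalIntegrable _ _)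
    rw [hP_def, prim_glue _ _ _ ht, this, hv0, add_sub_cancel]
  have hP0 : hist p P 0 = ξ.snd := hist_prim_glue_zero hc hf' hx
  have hPL : LocLp p P := LocLp.of_continuous hPc
  have hPv' : ∀ t, -1 ≤ t → P t = v t := by
    intro t ht
    rcases le_or_gt t 0 with h | h
    · have hae : P =ᵐ[histMeasure] v := by
        have h1 := hPL.coeFn_hist 0
        rw [hP0] at h1
        filter_upwards [h1, hvf] with σ e1 e2
        rw [← e2, e1, zero_add]
      exact Measure.eqOn_Icc_of_ae_eq volume (by norm_num : (-1 : ℝ) ≠ 0) hae hPc.continuousOn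
        (hvc.mono Icc_subset_Ici_self) ⟨ht, h⟩
    · exact hPv t h.le
  have hgraph : ∀ t, 0 ≤ t → W.GenRel (WithLp.toLp 1 (P t, hist p P t))
      (WithLp.toLp 1 (c t, hist p (glue c f') t)) := by
    intro t ht
    rw [genRel_iff_mem_graph hW, mem_graph_delayOp_iff]
    obtain ⟨hu, w, hw, e⟩ := hveq t ht
    have hwP : hist p P t = w := by
      refine hPL.hist_eq_of_ae (hw.trans ?_)
      filter_upwards [ae_mem_histInterval] with σ hσ
      rw [hPv' _ (by linarith [hσ.1])]
    have hD := hg.hasWeakDeriv_hist ξ.fst t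
    have hV := hg.hasValueAtZero_hist ξ.fst t
    rw [← hP_def] at hD hV
    rw [← hPv t ht] at hu
    refine ⟨hu, ⟨_, hD⟩, hV, hD, ?_⟩
    change c t = A ⟨P t, hu⟩ + Φ ⟨hist p P t, _⟩
    have e1 : (⟨hist p P t, ⟨_, hD⟩⟩ : sobolev 𝕜 X p) = w := Subtype.ext hwP
    have e2 : (⟨P t, hu⟩ : A.domain) = ⟨v t, by rwa [← hPv t ht]⟩ := Subtype.ext (hPv t ht)
    rw [e1, e2, ← e]
    simp only [c, max_eq_left ht]
  have hcont : Continuous fun t => (WithLp.toLp 1 (P t, hist p P t) : StateSpace X p) :=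
    (WithLp.prod_continuous_toLp 1 X (HistLp X p)).comp
      (hPc.prodMk (hPL.continuous_hist hp))
  have := C0Semigroup.eq_orbit_of_hasDerivWithinAt hWc hcont.continuousOn
    (fun t ht => ⟨_, hgraph t ht, hasDerivWithinAt_state hp hc f' ξ.fst ht⟩) ht
  have h0 : (WithLp.toLp 1 (P 0, hist p P 0) : StateSpace X p) = ξ := by
    rw [hP0, hP_def, prim_zero]
    rfl
  rw [h0] at this
  rw [← hPv t ht, ← this, WithLp.toLp_fst]

/-- Orbits of the perturbed semigroup starting in the domain give solutions. The second component
of the orbit consists of the segments of the first one: their difference `d` satisfies `d' = ∂_σ d`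
with `d(t)(0) = 0`, so that `(0, d)` is an orbit of the unperturbed delay semigroup starting
at `0`. -/
theorem exists_isSolution (hp : p ≠ ⊤) {A : X →ₗ.[𝕜] X} {S : C0Semigroup 𝕜 X}
    {Φ : sobolev 𝕜 X p →ₗ[𝕜] X}
    {W : C0Semigroup 𝕜 (StateSpace X p)} (hWc : W.IsCont) (hW : W.HasGenerator (delayOp A Φ))
    {ξ : StateSpace X p} (hξ : ξ ∈ delayDomain p A) :
    ∃ u : ℝ → X, IsSolution A Φ ξ.fst ξ.snd u := by
  obtain ⟨θ, hθ⟩ : ∃ θ, W.GenRel ξ θ :=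
    ⟨_, (genRel_iff_mem_graph hW).2 (LinearPMap.mem_graph (delayOp A Φ) ⟨ξ, hξ⟩)⟩
  have hgr : ∀ t, 0 ≤ t → (W.toFun t ξ, W.toFun t θ) ∈ (delayOp A Φ).graph := fun t ht =>
    (genRel_iff_mem_graph hW).1 (hθ.map ht)
  have hfst := (WithLp.fstL 1 𝕜 X (HistLp X p)).continuous
  let c : ℝ → X := fun t => (W.toFun t θ).fst
  have hc : Continuous c := hfst.comp (hWc θ)
  set P := prim ξ.fst (glue c θ.snd) with hP_def
  have hg : LocLp p (glue c θ.snd) := locLp_glue hc θ.snd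
  have hPc : Continuous P := hg.continuous_prim _
  have hPL : LocLp p P := LocLp.of_continuous hPc
  have hP : ∀ t, 0 ≤ t → P t = (W.toFun t ξ).fst := by
    intro t ht
    have h1 := congrArg (WithLp.fstL 1 𝕜 X (HistLp X p)) (hθ.integral_eq hWc ht)
    rw [← ContinuousLinearMap.intervalIntegral_comp_comm _
      (C0Semigroup.intervalIntegrable hWc _ _ _)] at h1
    have h2 : ∫ s in (0 : ℝ)..t, c s = (W.toFun t ξ).fst - ξ.fst := h1
    rw [hP_def, prim_glue _ _ _ ht, h2, add_sub_cancel]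
  obtain ⟨_, _, hv0, hw0, _⟩ := mem_graph_delayOp_iff.1 ((genRel_iff_mem_graph hW).1 hθ)
  have hP0 : hist p P 0 = ξ.snd := hist_prim_glue_zero hc hw0 hv0
  have hstate0 : (WithLp.toLp 1 (P 0, hist p P 0) : StateSpace X p) = ξ := by
    rw [hP0, hP_def, prim_zero]
    rfl
  let D : ℝ → StateSpace X p := fun t => W.toFun t ξ - WithLp.toLp 1 (P t, hist p P t)
  have hDc : Continuous D := (hWc ξ).sub ((WithLp.prod_continuous_toLp 1 X (HistLp X p)).comp
    (hPc.prodMk (hPL.continuous_hist hp)))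
  have hD0 : D 0 = 0 := by
    simp only [D]
    rw [hstate0, W.apply_zero, sub_self]
  have hDd : ∀ t, 0 ≤ t → ∃ η, (delaySemigroup (p := p) S hp).GenRel (D t) η ∧
      HasDerivWithinAt D η (Ioi t) t := by
    intro t ht
    refine ⟨W.toFun t θ - WithLp.toLp 1 (c t, hist p (glue c θ.snd) t), ?_,
      (hθ.hasDerivWithinAt ht).sub (hasDerivWithinAt_state hp hc θ.snd ξ.fst ht)⟩
    rw [genRel_delaySemigroup_iff]
    obtain ⟨_, _, ⟨F, hF, hfF, hF0⟩, hw, _⟩ := mem_graph_delayOp_iff.1 (hgr t ht)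
    obtain ⟨F', hF', hfF', hF0'⟩ := hg.hasValueAtZero_hist ξ.fst t
    have hwd := hg.hasWeakDeriv_hist ξ.fst t
    have e1 : (D t).fst = 0 := by
      change (W.toFun t ξ).fst - P t = 0
      rw [hP t ht, sub_self]
    have e2 : (W.toFun t θ - WithLp.toLp 1 (c t, hist p (glue c θ.snd) t)).fst = 0 :=
      sub_self (W.toFun t θ).fst
    rw [e1, e2]
    refine ⟨C0Semigroup.genRel_zero, ?_, F - F', hF.sub hF',
      (Lp.coeFn_sub (W.toFun t ξ).snd (hist p P t)).trans (hfF.sub hfF'), ?_⟩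
    · have := hw.add (hwd.smul (-1 : ℝ))
      rw [neg_one_smul ℝ (hist p (glue c θ.snd) t), neg_one_smul ℝ (hist p (prim _ _) t),
        ← sub_eq_add_neg, ← sub_eq_add_neg] at this
      exact this
    · rw [Pi.sub_apply, hF0, hF0', ← hP_def, hP t ht, sub_self]
  have hseg : ∀ t, 0 ≤ t → (W.toFun t ξ).snd = hist p P t := by
    intro t ht
    have h1 := C0Semigroup.eq_orbit_of_hasDerivWithinAt (isCont_delaySemigroup S hp)
      hDc.continuousOn hDd ht
    rw [hD0, map_zero] at h1
    exact congrArg WithLp.snd (sub_eq_zero.1 h1)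
  have hder : ∀ t, 0 ≤ t → HasDerivWithinAt P (c t) (Ici 0) t := fun t ht => by
    have h1 : HasDerivAt (fun t => ξ.fst + ∫ s in (0 : ℝ)..t, c s) (c t) t :=
      (intervalIntegral.integral_hasDerivAt_right (hc.intervalIntegrable _ _)
        (hc.stronglyMeasurableAtFilter _ _) hc.continuousAt).const_add ξ.fst
    exact h1.hasDerivWithinAt.congr (fun s hs => prim_glue _ _ _ hs) (prim_glue _ _ _ ht)
  have hdw : ∀ t, 0 ≤ t → derivWithin P (Ici 0) t = c t := fun t ht =>
    (hder t ht).derivWithin (uniqueDiffOn_Ici 0 t ht)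
  refine ⟨P, hPc.continuousOn, (contDiffOn_one_iff_derivWithin (uniqueDiffOn_Ici 0)).2
    ⟨fun t ht => (hder t ht).differentiableWithinAt, hc.continuousOn.congr hdw⟩, fun t ht => ?_,
    prim_zero _ _, ?_⟩
  · obtain ⟨hx, hf, _, _, e⟩ := mem_graph_delayOp_iff.1 (hgr t ht)
    have e1 : (⟨P t, by rwa [hP t ht]⟩ : A.domain) = ⟨(W.toFun t ξ).fst, hx⟩ :=
      Subtype.ext (hP t ht)
    refine ⟨by rwa [hP t ht], ⟨(W.toFun t ξ).snd, hf⟩, ?_, ?_⟩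
    · have h1 := hPL.coeFn_hist t
      rw [← hseg t ht] at h1
      exact h1
    · rw [hdw t ht, e1]
      exact e
  · have := hPL.coeFn_hist 0
    rw [hP0] at this
    simpa only [zero_add] using this

theorem wellPosed_of_hasGenerator (hp : p ≠ ⊤) {A : X →ₗ.[𝕜] X} (S : C0Semigroup 𝕜 X)
    {Φ : sobolev 𝕜 X p →ₗ[𝕜] X}
    {W : C0Semigroup 𝕜 (StateSpace X p)} (hWc : W.IsCont) (hW : W.HasGenerator (delayOp A Φ)) :
    WellPosed A Φ := by
  refine ⟨fun ξ hξ => ?_, fun ξ ζ hξ hζ hlim u v hu hv b hb => ?_⟩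
  · obtain ⟨u, hu⟩ := exists_isSolution hp (S := S) hWc hW hξ
    refine ⟨u, hu, fun v hv t ht => ?_⟩
    rcases le_or_gt t 0 with h | h
    · exact Measure.eqOn_Icc_of_ae_eq volume (by norm_num : (-1 : ℝ) ≠ 0)
        (hv.2.2.2.2.symm.trans hu.2.2.2.2) (hv.1.mono Icc_subset_Ici_self)
        (hu.1.mono Icc_subset_Ici_self) ⟨ht, h⟩
    · rw [hv.eq_orbit hp hWc hW hξ h.le, hu.eq_orbit hp hWc hW hξ h.le]
  · obtain ⟨C, hC0, hC⟩ := W.exists_bound b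
    rw [Metric.tendstoUniformlyOn_iff]
    intro ε hε
    have h1 : Tendsto (fun n => C * ‖ζ - ξ n‖) atTop (𝓝 0) := by
      have := ((tendsto_const_nhds (x := ζ)).sub hlim).norm.const_mul C
      simpa using this
    filter_upwards [h1.eventually (gt_mem_nhds hε)] with n hn t ht
    rw [dist_eq_norm, hv.eq_orbit hp hWc hW hζ ht.1, (hu n).eq_orbit hp hWc hW (hξ n) ht.1]
    refine lt_of_le_of_lt ?_ hn
    have e : (W.toFun t ζ).fst - (W.toFun t (ξ n)).fst = (W.toFun t (ζ - ξ n)).fst := by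
      rw [map_sub]
      rfl
    rw [e]
    exact (norm_fst_le _).trans ((W.toFun t).le_of_opNorm_le (hC t ht) _)

end Delay

end DelayEq

theorem mainTheorem2 {𝕜 X : Type*} [RCLike 𝕜] [NormedAddCommGroup X] [NormedSpace 𝕜 X]
    [NormedSpace ℝ X] [IsScalarTower ℝ 𝕜 X] [CompleteSpace X]
    (p : ℝ≥0∞) [Fact (1 ≤ p)] (hp : p ≠ ⊤)
    (A : X →ₗ.[𝕜] X) (S : DelayEq.C0Semigroup 𝕜 X) (hA : S.HasGenerator A)
    (Φ : DelayEq.sobolev 𝕜 X p →ₗ[𝕜] X) (hΦ : DelayEq.SobolevBounded Φ)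
    (hM : DelayEq.ConditionM A S Φ) :
    DelayEq.IsGenerator (DelayEq.delayOp A Φ) ∧ DelayEq.WellPosed A Φ := by
  obtain ⟨W, hWc, hW⟩ := DelayEq.exists_hasGenerator_delayOp hp hA hΦ hM
  exact ⟨⟨W, hW⟩, DelayEq.wellPosed_of_hasGenerator hp S hWc hW⟩
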